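/- Let $k$ be a field, $S=k[x_1,\dots,x_n]$, and for $c\ge 1$ let $S^{(c)}=\bigoplus_{i\ge 0}S_{ci}$ be the $c$-th Veronese subring, graded so that $S_{ci}$ has degree $i$. Let $h_{n,c}(z)\in\mathbb{Z}[z]$ be its $h$-polynomial, that is, the polynomial with $\sum_{i\ge0}\dim_k(S_{ci})z^i=h_{n,c}(z)/(1-z)^{\dim S^{(c)}}$. A surjective morphism $Q\to R$ of standard graded $k$-algebras with kernel contained in $(Q_{\ge1})^2$ is called Golod if $P^R_k(s,z)=\dfrac{P^Q_k(s,z)}{1-z\,(P^Q_R(s,z)-1)}$, where $P^A_M(s,z)=\sum_{i,j}\dim_k\mathrm{Tor}^A_i(k,M)_j\,s^jz^i$ is the graded Poincaré series. A standard graded $k$-algebra $R$ has the Backelin-Roos property if there is a surjective Golod morphism $Q\to R$ with $Q$ a standard graded complete intersection, i.e. the quotient of a polynomial ring over $k$ by an ideal generated by a homogeneous regular sequence. Then: 1. $h_{n,c}(-1)>0$ for $(n,c)=(7,2),(5,4),(5,3)$ and for $(n,c)=(4,c)$ with $c>4$. 2. $h_{4,c}(-1)=\tfrac13(c-4)(c^2+4c-6)$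 for every $c\ge1$. 3. For all the pairs $(n,c)$ listed in 1, $S^{(c)}$ does not have the Backelin-Roos property. -/

import Mathlib

open scoped Polynomial PowerSeries

section GradedAlgebras

variable {k A R : Type*} [Field k] [CommRing A] [Algebra k A] [CommRing R] [Algebra k R]

/-- `A = ⨁ i, 𝒜 i` is a standard graded `k`-algebra: `A` is a nonzero graded `k`-algebra with
`𝒜 0 = k` that is generated as a `k`-algebra by the finite-dimensional space `𝒜 1`. -/
structure IsStandardGraded (𝒜 : ℕ → Submodule k A) : Prop where
  nontrivial : Nontrivial A
  gradedMonoid : SetLike.GradedMonoid 𝒜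
  isInternal : DirectSum.IsInternal 𝒜
  zero_eq : 𝒜 0 = 1
  finite_one : Module.Finite k (𝒜 1)
  adjoin_one : Algebra.adjoin k (𝒜 1 : Set A) = ⊤

/-- The ideal `A_{≥ 1}` generated by the homogeneous elements of positive degree. -/
def irrelevantIdeal (𝒜 : ℕ → Submodule k A) : Ideal A :=
  Ideal.span {x | ∃ i, 0 < i ∧ x ∈ 𝒜 i}

/-- The grading of the `A`-module `k = A / A_{≥ 1}`, concentrated in degree `0`. -/
def residueGrading (𝒜 : ℕ → Submodule k A) : ℕ → Submodule k (A ⧸ irrelevantIdeal 𝒜) :=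
  fun j => if j = 0 then ⊤ else ⊥

/-- The homogeneous elements of degree `j` of the graded free module `⨁ a, A(-shift a)`, whose
basis element with index `a` has degree `shift a`. -/
def freeComponent (𝒜 : ℕ → Submodule k A) {r : ℕ} (shift : Fin r → ℕ) (j : ℕ) :
    Set (Fin r → A) :=
  {v | ∀ a, (shift a ≤ j ∧ v a ∈ 𝒜 (j - shift a)) ∨ v a = 0}

/-- A minimal graded free resolution
`⋯ → ⨁ b, A(-shift 1 b) → ⨁ a, A(-shift 0 a) → M → 0`
of the graded `A`-module `M = ⨁ j, ℳ j`, with all free modules of finite rank, all maps homogeneous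
of degree zero, and all entries of the matrices of the differentials in `A_{≥ 1}`. -/
structure MinimalGradedFreeResolution (𝒜 : ℕ → Submodule k A) {M : Type*} [AddCommGroup M]
    [Module k M] [Module A M] (ℳ : ℕ → Submodule k M) where
  rank : ℕ → ℕ
  shift : (i : ℕ) → Fin (rank i) → ℕ
  d : (i : ℕ) → (Fin (rank (i + 1)) → A) →ₗ[A] (Fin (rank i) → A)
  aug : (Fin (rank 0) → A) →ₗ[A] M
  aug_homogeneous : ∀ a, aug (Pi.single a 1) ∈ ℳ (shift 0 a)
  d_homogeneous : ∀ i b, d i (Pi.single b 1) ∈ freeComponent 𝒜 (shift i) (shift (i + 1) b)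
  d_minimal : ∀ i b a, d i (Pi.single b 1) a ∈ irrelevantIdeal 𝒜
  aug_surjective : Function.Surjective aug
  exact_zero : Function.Exact (d 0) aug
  exact_succ : ∀ i, Function.Exact (d (i + 1)) (d i)

/-- The graded Poincaré series `∑ i, ∑ j, β i j * s ^ j * z ^ i ∈ ℤ[s]⟦z⟧`, where `β i j`, the
dimension of `Tor i (k, M)` in degree `j`, is the number of basis elements of degree `j` in step `i`
of the minimal graded free resolution. -/
noncomputable def MinimalGradedFreeResolution.poincareSeries {𝒜 : ℕ → Submodule k A} {M : Type*}
    [AddCommGroup M] [Module k M] [Module A M] {ℳ : ℕ → Submodule k M}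
    (F : MinimalGradedFreeResolution 𝒜 ℳ) : ℤ[X]⟦X⟧ :=
  PowerSeries.mk fun i => ∑ a : Fin (F.rank i), (Polynomial.X : ℤ[X]) ^ F.shift i a

/-- A surjective Golod morphism `φ : A → R` of graded `k`-algebras: `φ` is surjective and
homogeneous of degree zero, its kernel lies in `(A_{≥ 1})²`, and
`P^R_k(s, z) = P^A_k(s, z) / (1 - z * (P^A_R(s, z) - 1))`.
The denominator has constant coefficient `1`, so the equality is written without a quotient.
Minimal graded free resolutions of finitely generated graded modules over a standard graded algebra
exist and are unique up to isomorphism, so the three series do not depend on the resolutions. -/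
def IsGolodSurjection (𝒜 : ℕ → Submodule k A) (ℛ : ℕ → Submodule k R) (φ : A →ₐ[k] R) : Prop :=
  letI : Module A R := Module.compHom R (φ : A →+* R)
  Function.Surjective φ ∧
  (∀ i, ∀ x ∈ 𝒜 i, φ x ∈ ℛ i) ∧
  RingHom.ker φ ≤ irrelevantIdeal 𝒜 ^ 2 ∧
  ∃ (FA : MinimalGradedFreeResolution 𝒜 (residueGrading 𝒜))
    (FR : MinimalGradedFreeResolution ℛ (residueGrading ℛ))
    (G : MinimalGradedFreeResolution 𝒜 ℛ),
    FR.poincareSeries * (1 - PowerSeries.X * (G.poincareSeries - 1)) = FA.poincareSeries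

/-- A graded `k`-algebra is a (standard graded) complete intersection if it is, as a graded algebra,
the quotient of a polynomial ring over `k` by an ideal generated by a regular sequence of
homogeneous polynomials. -/
def IsGradedCompleteIntersection (𝒜 : ℕ → Submodule k A) : Prop :=
  ∃ (m : ℕ) (π : MvPolynomial (Fin m) k →ₐ[k] A) (fs : List (MvPolynomial (Fin m) k)),
    Function.Surjective π ∧
    (∀ i p, p.IsHomogeneous i → π p ∈ 𝒜 i) ∧
    (∀ f ∈ fs, ∃ e, f.IsHomogeneous e) ∧
    RingTheory.Sequence.IsRegular (MvPolynomial (Fin m) k) fs ∧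
    RingHom.ker π = Ideal.ofList fs

/-- The Hilbert series `∑ i, dim_k (𝒜 i) * z ^ i`. -/
noncomputable def gradedHilbertSeries (𝒜 : ℕ → Submodule k A) : ℤ⟦X⟧ :=
  PowerSeries.mk fun i => (Module.finrank k (𝒜 i) : ℤ)

/-- `h` is the `h`-polynomial of the graded algebra `A = ⨁ i, 𝒜 i`: the Hilbert series equals
`h(z) / (1 - z) ^ d`, where `d` is the Krull dimension of `A`. -/
def IsHPolynomial (𝒜 : ℕ → Submodule k A) (h : ℤ[X]) : Prop :=
  ∃ d : ℕ, ringKrullDim A = d ∧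
    (h : ℤ⟦X⟧) = gradedHilbertSeries 𝒜 * (1 - PowerSeries.X) ^ d

theorem IsHPolynomial.unique {𝒜 : ℕ → Submodule k A} {h h' : ℤ[X]}
    (H : IsHPolynomial 𝒜 h) (H' : IsHPolynomial 𝒜 h') : h = h' := by
  obtain ⟨d, hd, e⟩ := H
  obtain ⟨d', hd', e'⟩ := H'
  have hdd : d = d' := by
    rw [hd] at hd'
    exact_mod_cast hd'
  subst hdd
  exact Polynomial.coe_injective ℤ (e.trans e'.symm)

end GradedAlgebras

/-- The graded `k`-algebra `R = ⨁ i, ℛ i` has the Backelin-Roos property: there is a surjective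
Golod morphism `Q → R` from a standard graded complete intersection `Q`. -/
def HasBackelinRoosProperty.{u} {k R : Type u} [Field k] [CommRing R] [Algebra k R]
    (ℛ : ℕ → Submodule k R) : Prop :=
  ∃ (Q : Type u) (_ : CommRing Q) (_ : Algebra k Q) (𝒬 : ℕ → Submodule k Q) (φ : Q →ₐ[k] R),
    IsStandardGraded 𝒬 ∧ IsGradedCompleteIntersection 𝒬 ∧ IsGolodSurjection 𝒬 ℛ φ

/-- The `c`-th Veronese subring `S^(c) = ⨁ i, S_{ci}` of `S = k[x_1, …, x_n]`: the polynomials all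
of whose monomials have degree divisible by `c`. -/
noncomputable def veroneseSubring (k : Type*) [Field k] (n c : ℕ) : Subalgebra k (MvPolynomial (Fin n) k) where
  carrier := {p | ∀ m ∈ p.support, c ∣ m.degree}
  mul_mem' := by
    classical
    intro p q hp hq m hm
    obtain ⟨a, ha, b, hb, rfl⟩ := Finset.mem_add.1 (MvPolynomial.support_mul p q hm)
    rw [map_add]
    exact dvd_add (hp a ha) (hq b hb)
  add_mem' := by
    classical
    intro p q hp hq m hm
    rcases Finset.mem_union.1 (MvPolynomial.support_add hm) with h | h
    · exact hp m h
    · exact hq m h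
  algebraMap_mem' := by
    classical
    intro r m hm
    have h : m = 0 := by
      by_contra hne
      rw [MvPolynomial.mem_support_iff, MvPolynomial.algebraMap_eq, MvPolynomial.coeff_C,
        if_neg (Ne.symm hne)] at hm
      exact hm rfl
    subst h
    simp

/-- The grading of `S^(c)` whose component of degree `i` is `S_{ci}`. -/
noncomputable def veroneseGrading (k : Type*) [Field k] (n c : ℕ) :
    ℕ → Submodule k (veroneseSubring k n c) :=
  fun i => (MvPolynomial.homogeneousSubmodule (Fin n) k (c * i)).comap
    (veroneseSubring k n c).val.toLinearMap

/-- The pairs `(7,2)`, `(5,4)`, `(5,3)`, and `(4,c)` with `c > 4`. -/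
def IsObstructedPair (n c : ℕ) : Prop :=
  (n = 7 ∧ c = 2) ∨ (n = 5 ∧ c = 4) ∨ (n = 5 ∧ c = 3) ∨ (n = 4 ∧ 4 < c)

/-! The obstruction compares linear strands. Let `Q → R` be Golod with `Q` a complete intersection
and `R` the Veronese subring. `R` is Koszul (`veronese_shift_eq`), so its Poincaré series is `∑ r_i
s^i z^i`, and the Euler characteristic of the resolution gives `r(z) H_R(-z) = 1`. Extracting the
coefficients of `s^i z^i` from the Golod identity therefore yields `r(z) (1 - B(z)) = D(z)`, where
`D` counts the linear strand of `k` over `Q` and `B` has nonnegative coefficients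
(`exists_diagonal_identity`). Since `h(-z) = H_R(-z) (1 + z)^n`, it follows that `h(-z) D(z) = (1 -
B(z)) (1 + z)^n`.

The crucial point is that `D` grows polynomially (`polyGrowth_bettiDiag`), so `D(u)` converges for
`0 < u < 1`. Nonnegativity of `B` then gives `h(-u) D(u) ≤ (1 + u)^n`. As `D(u) ≥ 1 + u dim R_1`,
the limit `u → 1` shows `h(-1) (1 + dim R_1) ≤ 2^n`, which fails for all the listed pairs.

For the growth of `D`, the linear part of the differential gives operators `x_a` of degree `-1`
satisfying the relations of the quadratic dual of `Q`. The quadrics defining `Q` come from a regular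
sequence, hence have no linear syzygies, and this makes the quadratic operators `t_l` dual to them
commute with every `x_a`. Modulo the `t_l` the `x_a` behave as in an exterior algebra. Taking
kernels of these finitely many operators one at a time leaves only degree `0`, and each one raises
the growth exponent by at most one.

Koszulness is proved by base change of the resolution to `S`, killing the variables one at a time:
exactness is known in degrees divisible by `c` before any variable is killed, and trivial in the
other degrees after all are killed. The long exact sequences of multiplication by a variable connect
the two ends. -/

/-! ### Polynomial growth -/

/-- A sequence of natural numbers bounded by a polynomial. -/
def PolyGrowth (a : ℕ → ℕ) : Prop :=
  ∃ C d : ℕ, ∀ i, a i ≤ C * (i + 1) ^ d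

theorem PolyGrowth.of_recursive_le {a b : ℕ → ℕ} {e : ℕ} (he : 0 < e) (hb : PolyGrowth b)
    (h : ∀ i, a (i + e) ≤ b (i + e) + a i) : PolyGrowth a := by
  obtain ⟨C, d, hC⟩ := hb
  set A := ∑ j ∈ Finset.range e, a j with hA
  -- `A` covers the initial values `i < e`. Summing a bound of degree `d` along steps of length `e`
  -- costs one degree.
  refine ⟨C + A, d + 1, fun i => ?_⟩
  induction i using Nat.strong_induction_on with
  | _ i ih =>
    rcases lt_or_ge i e with hi | hi
    · have h1 : a i ≤ A := Finset.single_le_sum (f := a) (fun _ _ => Nat.zero_le _)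
        (Finset.mem_range.2 hi)
      exact (h1.trans (Nat.le_add_left _ _)).trans
        (Nat.le_mul_of_pos_right _ (pow_pos (Nat.succ_pos _) _))
    · obtain ⟨j, rfl⟩ := Nat.exists_eq_add_of_le' hi
      have h1 := h j
      have h2 := ih j (by omega)
      have h3 := hC (j + e)
      have h4 : (j + 1) ^ d ≤ (j + e + 1) ^ d := Nat.pow_le_pow_left (by omega) d
      calc a (j + e) ≤ C * (j + e + 1) ^ d + (C + A) * ((j + 1) ^ d * (j + 1)) := by
            rw [← pow_succ]; omega
        _ ≤ (C + A) * (j + e + 1) ^ d + (C + A) * ((j + e + 1) ^ d * (j + 1)) := by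
            gcongr; exact Nat.le_add_right C A
        _ = (C + A) * ((j + e + 1) ^ d * (j + 2)) := by ring
        _ ≤ (C + A) * ((j + e + 1) ^ d * (j + e + 1)) :=
            Nat.mul_le_mul_left _ (Nat.mul_le_mul_left _ (by omega))
        _ = _ := by rw [pow_succ]

/-! ### Growth controlled by kernels of lowering operators -/

section KernelChain

variable {k M : Type*} [Field k] [AddCommGroup M] [Module k M]

/-- Rank-nullity for the restriction of `T`. With `W = G (i + e)` and `U = G i` it is the recursion
required by `PolyGrowth.of_recursive_le`. -/
theorem finrank_le_finrank_inf_ker_add (T : Module.End k M) (W U : Submodule k M)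
    [FiniteDimensional k W] [FiniteDimensional k U] (h : ∀ v ∈ W, T v ∈ U) :
    Module.finrank k W ≤ Module.finrank k (W ⊓ LinearMap.ker T : Submodule k M) +
      Module.finrank k U := by
  let T' : W →ₗ[k] U := T.restrict h
  have h1 := T'.finrank_range_add_finrank_ker
  have h2 : Module.finrank k (LinearMap.range T') ≤ Module.finrank k U := Submodule.finrank_le _
  have h3 : Module.finrank k (LinearMap.ker T') ≤
      Module.finrank k (W ⊓ LinearMap.ker T : Submodule k M) := by
    rw [← Submodule.finrank_map_subtype_eq W (LinearMap.ker T')]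
    have : FiniteDimensional k (W ⊓ LinearMap.ker T : Submodule k M) :=
      Submodule.finiteDimensional_of_le inf_le_left
    apply Submodule.finrank_mono
    rintro _ ⟨w, hw, rfl⟩
    refine ⟨w.2, ?_⟩
    have := congrArg Subtype.val (LinearMap.mem_ker.1 hw)
    simpa [T'] using this
  omega

/-- Growth of a graded vector space `G` is controlled by growth of the joint kernel of finitely many
operators of degree `-e`, provided that the kernel of each operator is stable under the others. -/
theorem PolyGrowth.of_joint_ker {e : ℕ} (he : 0 < e) (L : List (Module.End k M)) :
    ∀ (G : ℕ → Submodule k M) [∀ i, FiniteDimensional k (G i)],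
      (∀ T ∈ L, ∀ i, ∀ v ∈ G (i + e), T v ∈ G i) →
      (∀ T ∈ L, ∀ T' ∈ L, ∀ i, ∀ v ∈ G i, T v = 0 → T (T' v) = 0) →
      PolyGrowth (fun i => Module.finrank k
        (G i ⊓ ⨅ T ∈ L, LinearMap.ker T : Submodule k M)) →
      PolyGrowth fun i => Module.finrank k (G i) := by
  induction L with
  | nil =>
    intro G _ _ _ h
    have h0 : ∀ i, G i ⊓ ⨅ T ∈ ([] : List (Module.End k M)), LinearMap.ker T = G i := by simp
    exact (congrArg PolyGrowth (funext fun i => by rw [h0 i])).mp h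
  | cons T L ih =>
    intro G _ hst hker h
    have : ∀ i, FiniteDimensional k (G i ⊓ LinearMap.ker T : Submodule k M) := fun i =>
      Submodule.finiteDimensional_of_le inf_le_left
    -- The remaining operators act on `ker T` by the stability hypothesis, so the induction applies
    -- to the smaller graded space.
    refine PolyGrowth.of_recursive_le he (ih (fun i => G i ⊓ LinearMap.ker T) ?_ ?_ ?_) fun i =>
      finrank_le_finrank_inf_ker_add T (G (i + e)) (G i) (hst T (by simp) i)
    · rintro T' hT' i v ⟨hv, hv0⟩
      exact ⟨hst T' (by simp [hT']) i v hv,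
        hker T (by simp) T' (by simp [hT']) _ v hv hv0⟩
    · rintro T₁ h₁ T₂ h₂ i v ⟨hv, -⟩
      exact hker T₁ (by simp [h₁]) T₂ (by simp [h₂]) i v hv
    · have h0 : ∀ i, G i ⊓ ⨅ T' ∈ T :: L, LinearMap.ker T' =
          G i ⊓ LinearMap.ker T ⊓ ⨅ T' ∈ L, LinearMap.ker T' := fun i => by
        simp only [List.mem_cons, iInf_or, iInf_inf_eq, iInf_iInf_eq_left, inf_assoc]
      exact (congrArg PolyGrowth (funext fun i => by rw [h0 i])).mp h

end KernelChain

/-! ### Operators satisfying quadratic dual relations -/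

section QuadraticDual

variable {k M Q : Type*} [Field k] [AddCommGroup M] [Module k M] [CommRing Q] [Algebra k Q]

open MvPolynomial in
/-- Let the operators `x a` satisfy the relations dual to the multiplication `Q₁ ⊗ Q₁ → Q₂`. If the
quadratic relations `F l` of `Q` have no linear syzygies, then the graded space `G` on which the
`x a` of degree `-1` act with trivial joint kernel has polynomial growth. -/
theorem polyGrowth_of_no_linear_syzygies {m : ℕ} {ι : Type*} [Fintype ι] (x : Fin m → Module.End k M)
    (G : ℕ → Submodule k M) [∀ i, FiniteDimensional k (G i)]
    (hx : ∀ a i, ∀ v ∈ G (i + 1), x a v ∈ G i)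
    (hinj : ∀ i, ∀ v ∈ G (i + 1), (∀ a, x a v = 0) → v = 0)
    (e : Fin m → Q)
    (hrel : ∀ (μ : Q →ₗ[k] k) (v : M), ∑ a, ∑ b, μ (e a * e b) • x b (x a v) = 0)
    (F : ι → MvPolynomial (Fin m) k)
    (hspan : ∀ p : MvPolynomial (Fin m) k, p.IsHomogeneous 2 → aeval e p = 0 →
      ∃ c : ι → k, p = ∑ l, c l • F l)
    (hsyz : ∀ g : ι → MvPolynomial (Fin m) k, (∃ j ≤ 1, ∀ l, (g l).IsHomogeneous j) →
      ∑ l, g l * F l = 0 → ∀ l, g l = 0) :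
    PolyGrowth fun i => Module.finrank k (G i) := by
  classical
  have hli : LinearIndependent k F := by
    rw [Fintype.linearIndependent_iff]
    intro c hc l
    have := hsyz (fun l => C (c l)) ⟨0, zero_le_one, fun l => isHomogeneous_C _ _⟩
      (by simpa [MvPolynomial.smul_eq_C_mul] using hc) l
    simpa using this
  -- The `F l` are independent, being without syzygies of degree `0`. So `τ` can read off the
  -- coordinates of a combination of them, and applied to `X a * X b` it gives the coefficients of
  -- the dual operators `t l`.
  obtain ⟨τ, hτ⟩ : ∃ τ : MvPolynomial (Fin m) k →ₗ[k] (ι → k),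
      ∀ c : ι → k, τ (∑ l, c l • F l) = c := by
    obtain ⟨τ, hτ⟩ := LinearMap.exists_leftInverse_of_injective
      (Fintype.linearCombination k F) (LinearMap.ker_eq_bot.2
        (linearIndependent_iff_injective_fintypeLinearCombination.1 hli))
    exact ⟨τ, fun c => by simpa [Fintype.linearCombination_apply] using LinearMap.congr_fun hτ c⟩
  let t : ι → Module.End k M := fun l =>
    ∑ a, ∑ b, τ (X a * X b) l • (x b * x a)
  have ht : ∀ l v, t l v = ∑ a, ∑ b, τ (X a * X b) l • x b (x a v) := fun l v => by
    simp only [t, LinearMap.sum_apply, LinearMap.smul_apply, Module.End.mul_apply]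
  clear_value t
  -- By `hrel` the quadric with coefficients `lam (x b (x a v))` is a relation of `Q`, hence a
  -- combination of the `F l`; `τ` identifies its coordinates.
  have key : ∀ (lam : M →ₗ[k] k) (v : M),
      ∑ a, ∑ b, lam (x b (x a v)) • (X a * X b : MvPolynomial (Fin m) k) =
        ∑ l, lam (t l v) • F l := by
    intro lam v
    set p : MvPolynomial (Fin m) k :=
      ∑ a, ∑ b, lam (x b (x a v)) • (X a * X b : MvPolynomial (Fin m) k) with hp
    have hp2 : p.IsHomogeneous 2 := by
      refine IsHomogeneous.sum _ _ _ fun a _ => IsHomogeneous.sum _ _ _ fun b _ => ?_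
      rw [MvPolynomial.smul_eq_C_mul]
      exact ((isHomogeneous_X k a).mul (isHomogeneous_X k b)).C_mul _
    have hp0 : aeval e p = 0 := by
      rw [← Module.forall_dual_apply_eq_zero_iff k]
      intro μ
      have := congrArg lam (hrel μ v)
      simp only [map_sum, map_smul, map_zero, smul_eq_mul] at this
      simp only [hp, map_sum, map_smul, map_mul, aeval_X, smul_eq_mul]
      rw [← this]
      exact Finset.sum_congr rfl fun a _ => Finset.sum_congr rfl fun b _ => mul_comm _ _
    obtain ⟨c, hc⟩ := hspan p hp2 hp0
    have hcl : ∀ l, c l = lam (t l v) := by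
      intro l
      have h1 : τ p = c := by rw [hc, hτ]
      rw [← h1, hp]
      simp only [ht, map_sum, map_smul, Finset.sum_apply, Pi.smul_apply, smul_eq_mul]
      exact Finset.sum_congr rfl fun a _ => Finset.sum_congr rfl fun b _ => mul_comm _ _
    rw [hc]
    simp only [hcl]
  -- The cubic with coefficients `lam (x b (x a (x c v)))` can be rewritten by `key` on its outer
  -- two operators or on its inner two. The difference is a linear syzygy of the `F l` with
  -- coefficients `lam (t l (x c v) - x c (t l v))`, so these vanish.
  have hcentral : ∀ l c v, t l (x c v) = x c (t l v) := by
    intro l c v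
    rw [← sub_eq_zero, ← Module.forall_dual_apply_eq_zero_iff k]
    intro lam
    have h1 : ∑ c, (X c : MvPolynomial (Fin m) k) * ∑ a, ∑ b,
        lam (x b (x a (x c v))) • (X a * X b : MvPolynomial (Fin m) k) =
        ∑ c, X c * ∑ l, lam (t l (x c v)) • F l :=
      Finset.sum_congr rfl fun c _ => by rw [key lam (x c v)]
    have h2 : ∑ b, (X b : MvPolynomial (Fin m) k) * ∑ c, ∑ a,
        lam (x b (x a (x c v))) • (X c * X a : MvPolynomial (Fin m) k) =
        ∑ b, X b * ∑ l, lam (x b (t l v)) • F l :=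
      Finset.sum_congr rfl fun b _ => congrArg _ (key (lam ∘ₗ x b) v)
    have h3 : ∑ c, (X c : MvPolynomial (Fin m) k) * ∑ a, ∑ b,
        lam (x b (x a (x c v))) • (X a * X b : MvPolynomial (Fin m) k) =
        ∑ b, (X b : MvPolynomial (Fin m) k) * ∑ c, ∑ a,
        lam (x b (x a (x c v))) • (X c * X a : MvPolynomial (Fin m) k) := by
      simp only [Finset.mul_sum, mul_smul_comm]
      rw [Finset.sum_congr rfl fun c _ => Finset.sum_comm, Finset.sum_comm]
      refine Finset.sum_congr rfl fun b _ => Finset.sum_congr rfl fun c _ =>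
        Finset.sum_congr rfl fun a _ => ?_
      rw [mul_comm (X a), mul_left_comm]
    have h4 : ∑ l, (∑ c, lam (t l (x c v) - x c (t l v)) • (X c : MvPolynomial (Fin m) k)) *
        F l = 0 := by
      have h5 := (h1.symm.trans h3).trans h2
      rw [← sub_eq_zero] at h5
      rw [← h5, ← Finset.sum_sub_distrib]
      simp only [Finset.sum_mul, Finset.mul_sum, ← Finset.sum_sub_distrib]
      rw [Finset.sum_comm]
      refine Finset.sum_congr rfl fun c _ => Finset.sum_congr rfl fun l _ => ?_
      rw [map_sub, sub_smul, sub_mul, smul_mul_assoc, smul_mul_assoc, mul_smul_comm, mul_smul_comm]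
    have h5 := hsyz _ ⟨1, le_rfl, fun l => IsHomogeneous.sum _ _ _ fun c _ => by
      rw [MvPolynomial.smul_eq_C_mul]; exact (isHomogeneous_X k c).C_mul _⟩ h4 l
    have h6 := congrArg (coeff (Finsupp.single c 1)) h5
    simpa [coeff_sum, coeff_X, Finsupp.single_left_inj] using h6
  have htG : ∀ l i, ∀ v ∈ G (i + 2), t l v ∈ G i := by
    intro l i v hv
    rw [ht]
    exact Submodule.sum_mem _ fun a _ => Submodule.sum_mem _ fun b _ =>
      Submodule.smul_mem _ _ (hx b i _ (hx a (i + 1) v hv))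
  have htt : ∀ l l' v, t l v = 0 → t l (t l' v) = 0 := by
    intro l l' v hv
    have : t l (t l' v) = t l' (t l v) := by
      simp only [ht l, hcentral, map_sum, map_smul]
    rw [this, hv, map_zero]
  refine PolyGrowth.of_joint_ker (e := 2) two_pos (Finset.univ.toList.map t) G ?_ ?_ ?_
  · intro T hT
    obtain ⟨l, -, rfl⟩ := List.mem_map.1 hT
    exact htG l
  · intro T hT T' hT' i v _
    obtain ⟨l, -, rfl⟩ := List.mem_map.1 hT
    obtain ⟨l', -, rfl⟩ := List.mem_map.1 hT'
    exact htt l l' v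
  have hmem : ∀ i v, v ∈ (G i ⊓ ⨅ T ∈ Finset.univ.toList.map t, LinearMap.ker T : Submodule k M) ↔
      v ∈ G i ∧ ∀ l, t l v = 0 := by
    intro i v
    simp [Submodule.mem_iInf]
  have : ∀ i, FiniteDimensional k (G i ⊓ ⨅ T ∈ Finset.univ.toList.map t, LinearMap.ker T : Submodule k M) :=
    fun i => Submodule.finiteDimensional_of_le inf_le_left
  -- The central `t l` have been dealt with; the `x a` now act on their joint kernel.
  refine PolyGrowth.of_joint_ker (e := 1) one_pos (List.ofFn x) _ ?_ ?_ ?_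
  · intro T hT i v hv
    obtain ⟨a, rfl⟩ := (List.mem_ofFn' _ _).1 hT
    rw [hmem] at hv ⊢
    exact ⟨hx a i v hv.1, fun l => by rw [hcentral, hv.2 l, map_zero]⟩
  · intro T hT T' hT' i v hv hv0
    obtain ⟨a, rfl⟩ := (List.mem_ofFn' _ _).1 hT
    obtain ⟨b, rfl⟩ := (List.mem_ofFn' _ _).1 hT'
    rw [hmem] at hv
    rw [← Module.forall_dual_apply_eq_zero_iff k]
    intro lam
    have h1 := key lam v
    simp only [hv.2, map_zero, zero_smul, Finset.sum_const_zero] at h1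
    -- On the joint kernel of the `t l` the quadric of `key` is zero. For `a ≠ b` its coefficient at
    -- `X a * X b` says that `x a` and `x b` anticommute on `v`, so `x b` preserves the kernel of `x
    -- a`.
    have h2 := congrArg (coeff (Finsupp.single b 1 + Finsupp.single a 1)) h1
    have hcoeff : ∀ a' b', coeff (Finsupp.single b 1 + Finsupp.single a 1)
        (X a' * X b' : MvPolynomial (Fin m) k) =
        if (a' = b ∧ b' = a) ∨ (a' = a ∧ b' = b) then 1 else 0 := by
      intro a' b'
      rw [X, X, monomial_mul, coeff_monomial, one_mul]
      refine if_congr ?_ rfl rfl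
      rw [Finsupp.single_add_single_eq_single_add_single one_ne_zero one_ne_zero]
      simp
    simp only [coeff_sum, coeff_smul, hcoeff, coeff_zero] at h2
    rw [Finset.sum_eq_single b, Finset.sum_eq_single a] at h2
    · simpa using h2
    · intro b' _ hb'
      by_cases hba : b = a
      · subst hba; simp [hv0]
      · simp [hb', hba]
    · simp
    · intro a' _ ha'
      refine Finset.sum_eq_zero fun b' _ => ?_
      by_cases haa : a' = a
      · subst haa; simp [hv0]
      · simp [ha', haa]
    · simp
  -- By `hinj` the joint kernel of the `x a` is zero in positive degrees, so a constant bound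
  -- suffices.
  · refine ⟨Module.finrank k (G 0), 0, fun i => ?_⟩
    rw [pow_zero, mul_one]
    rcases i with _ | i
    · exact Submodule.finrank_mono (inf_le_left.trans inf_le_left)
    · refine ((Submodule.finrank_eq_zero (R := k)).2 ?_).le.trans (Nat.zero_le _)
      rw [Submodule.eq_bot_iff]
      · rintro v ⟨hv, hv'⟩
        refine hinj i v ((hmem _ _).1 hv).1 fun a => ?_
        simp only [SetLike.mem_coe, Submodule.mem_iInf] at hv'
        exact hv' (x a) ((List.mem_ofFn' _ _).2 ⟨a, rfl⟩)

end QuadraticDual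

/-! ### Syzygies of regular sequences -/

theorem MvPolynomial.homogeneousComponent_mul_of_isHomogeneous {σ k : Type*} [CommSemiring k]
    {f : MvPolynomial σ k} {e : ℕ} (hf : f.IsHomogeneous e) (g : MvPolynomial σ k) (d : ℕ) :
    homogeneousComponent d (g * f) = if e ≤ d then homogeneousComponent (d - e) g * f else 0 := by
  classical
  have h : g * f = ∑ i ∈ Finset.range (g.totalDegree + 1), homogeneousComponent i g * f := by
    rw [← Finset.sum_mul, sum_homogeneousComponent]
  have h' : ∀ i, homogeneousComponent d (homogeneousComponent i g * f) =
      if d = i + e then homogeneousComponent i g * f else 0 := fun i =>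
    homogeneousComponent_of_mem ((homogeneousComponent_isHomogeneous i g).mul hf)
  rw [h, map_sum, Finset.sum_congr rfl fun i _ => h' i]
  split_ifs with hed
  · rw [Finset.sum_eq_single (d - e)]
    · rw [if_pos (by omega)]
    · intro i _ hi
      rw [if_neg (by omega)]
    · intro hi
      rw [homogeneousComponent_eq_zero _ _ (by rw [Finset.mem_range] at hi; omega), zero_mul, ite_self]
  · exact Finset.sum_eq_zero fun i _ => if_neg (by omega)

section RegularSequence

variable {R : Type*} [CommRing R]

/-- The coefficients of a relation between the elements of a regular sequence lie in the ideal
generated by the sequence. -/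
theorem mem_span_of_sum_mul_eq_zero (f : ℕ → R) (n : ℕ)
    (hreg : ∀ j < n, ∀ x, f j * x ∈ Ideal.span (Set.range fun i : Fin j => f i) →
      x ∈ Ideal.span (Set.range fun i : Fin j => f i))
    (g : Fin n → R) (hg : ∑ i, g i * f i = 0) (i : Fin n) :
    g i ∈ Ideal.span (Set.range fun i : Fin n => f i) := by
  induction n with
  | zero => exact i.elim0
  | succ n ih =>
    rw [Fin.sum_univ_castSucc] at hg
    have hle : Ideal.span (Set.range fun i : Fin n => f i) ≤
        Ideal.span (Set.range fun i : Fin (n + 1) => f i) := by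
      refine Ideal.span_mono ?_
      rintro _ ⟨i, rfl⟩
      exact ⟨i.castSucc, rfl⟩
    -- Regularity of `f n` modulo its predecessors handles the last coefficient. Writing it as `∑ h
    -- i * f i` moves that term into the others and leaves a shorter relation.
    have hlast : g (Fin.last n) ∈ Ideal.span (Set.range fun i : Fin n => f i) := by
      refine hreg n (Nat.lt_succ_self n) _ (Ideal.mem_span_range_iff_exists_fun.2
        ⟨fun i => -g i.castSucc, ?_⟩)
      simp only [neg_mul, Finset.sum_neg_distrib]
      rw [neg_eq_iff_add_eq_zero, mul_comm (f n)]
      simpa using hg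
    obtain ⟨h, hh⟩ := Ideal.mem_span_range_iff_exists_fun.1 hlast
    have hsum : ∑ i : Fin n, (g i.castSucc + h i * f n) * f i = 0 := by
      rw [← hg, ← hh, Finset.sum_mul, ← Finset.sum_add_distrib]
      refine Finset.sum_congr rfl fun i _ => ?_
      simp only [Fin.val_castSucc, Fin.val_last]
      ring
    induction i using Fin.lastCases with
    | last => exact hle hlast
    | cast i =>
      have h1 := hle (ih (fun j hj => hreg j (hj.trans (Nat.lt_succ_self n))) _ hsum i)
      have h2 : h i * f n ∈ Ideal.span (Set.range fun i : Fin (n + 1) => f i) :=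
        Ideal.mul_mem_left _ _ (Ideal.subset_span ⟨Fin.last n, rfl⟩)
      simpa using Ideal.sub_mem _ h1 h2

theorem mem_ofList_of_sum_mul_get_eq_zero {fs : List R}
    (hfs : RingTheory.Sequence.IsWeaklyRegular R fs) (g : Fin fs.length → R)
    (hg : ∑ i, g i * fs.get i = 0) (i : Fin fs.length) : g i ∈ Ideal.ofList fs := by
  have hspan : ∀ j ≤ fs.length, Ideal.span (Set.range fun i : Fin j => fs.getD i 0) =
      Ideal.ofList (fs.take j) := by
    intro j hj
    refine congrArg Ideal.span (Set.ext fun x => ?_)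
    simp only [Set.mem_range, Set.mem_ofPred_eq, List.mem_take_iff_getElem]
    constructor
    · rintro ⟨i, rfl⟩
      exact ⟨i, by omega, by rw [List.getD_eq_getElem]⟩
    · rintro ⟨i, hi, rfl⟩
      exact ⟨⟨i, by omega⟩, by rw [List.getD_eq_getElem]⟩
  have := mem_span_of_sum_mul_eq_zero (fun i => fs.getD i 0) fs.length ?_ g ?_ i
  · rwa [hspan _ le_rfl, List.take_length] at this
  · intro j hj x hx
    rw [hspan j hj.le] at hx ⊢
    have h1 := hfs.regular_mod_prev j hj
    have h2 : ∀ y : R, (Submodule.Quotient.mk y :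
        R ⧸ (Ideal.ofList (fs.take j) • ⊤ : Submodule R R)) = 0 ↔ y ∈ Ideal.ofList (fs.take j) := by
      intro y
      rw [Submodule.Quotient.mk_eq_zero]
      simp
    rw [← h2] at hx ⊢
    rw [List.getD_eq_getElem _ _ hj] at hx
    refine h1 ?_
    simp only [smul_zero]
    rw [← hx, ← smul_eq_mul, Submodule.Quotient.mk_smul]
  · rw [← hg]
    exact Finset.sum_congr rfl fun i _ => by simp

end RegularSequence

theorem Finset.sum_subtype_eq_sum_dite {ι M : Type*} [Fintype ι] [AddCommMonoid M] (p : ι → Prop)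
    [DecidablePred p] (g : {l // p l} → M) :
    ∑ l, g l = ∑ l, if h : p l then g ⟨l, h⟩ else 0 := by
  rw [← Finset.sum_filter_of_ne (p := p), Finset.sum_subtype (p := p) _ (by simp)]
  · exact Finset.sum_congr rfl fun l _ => by rw [dif_pos l.2]
  · intro l _ hl
    by_contra h
    exact hl (dif_neg h)

/-! ### Quadrics of a graded complete intersection -/

section GradedAlgebras

variable {k A : Type*} [Field k] [CommRing A] [Algebra k A]

/-- The graded algebra structure of a standard graded algebra. -/
@[reducible]
noncomputable def IsStandardGraded.gradedAlgebra {𝒜 : ℕ → Submodule k A}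
    (h : IsStandardGraded 𝒜) : GradedAlgebra 𝒜 :=
  letI := h.gradedMonoid
  letI := h.isInternal.chooseDecomposition
  { }

theorem IsStandardGraded.exists_homogeneous_lift {𝒜 : ℕ → Submodule k A} (h : IsStandardGraded 𝒜)
    {σ : Type*} (π : MvPolynomial σ k →ₐ[k] A) (hπ : Function.Surjective π)
    (hdeg : ∀ i p, p.IsHomogeneous i → π p ∈ 𝒜 i) {j : ℕ} {x : A} (hx : x ∈ 𝒜 j) :
    ∃ p, p.IsHomogeneous j ∧ π p = x := by
  let := h.gradedAlgebra
  obtain ⟨p, rfl⟩ := hπ x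
  refine ⟨MvPolynomial.homogeneousComponent j p,
    MvPolynomial.homogeneousComponent_isHomogeneous _ _, ?_⟩
  have h1 : (DirectSum.decompose 𝒜 (π p) j : A) = π p := DirectSum.decompose_of_mem_same 𝒜 hx
  have h2 : ∀ i, (DirectSum.decompose 𝒜 (π (MvPolynomial.homogeneousComponent i p)) j : A) =
      if i = j then π (MvPolynomial.homogeneousComponent i p) else 0 := by
    intro i
    have hi := hdeg i _ (MvPolynomial.homogeneousComponent_isHomogeneous i p)
    split_ifs with hij
    · subst hij; exact DirectSum.decompose_of_mem_same 𝒜 hi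
    · exact DirectSum.decompose_of_mem_ne 𝒜 hi hij
  conv_rhs => rw [← h1, ← MvPolynomial.sum_homogeneousComponent p]
  rw [map_sum, DirectSum.decompose_sum, DFinsupp.finsetSum_apply, AddSubmonoidClass.coe_finsetSum,
    Finset.sum_congr rfl fun i _ => h2 i, Finset.sum_ite_eq']
  split_ifs with hj
  · rfl
  · rw [MvPolynomial.homogeneousComponent_eq_zero _ _ (by rw [Finset.mem_range] at hj; omega),
      map_zero]

open MvPolynomial in
/-- The quadratic relations of a graded complete intersection, written in a basis of its linear
forms, have no linear syzygies. -/
theorem IsGradedCompleteIntersection.exists_quadrics {𝒜 : ℕ → Submodule k A}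
    (h : IsGradedCompleteIntersection 𝒜) (hstd : IsStandardGraded 𝒜) {m : ℕ}
    (b : Module.Basis (Fin m) k (𝒜 1)) :
    ∃ (ι : Type) (_ : Fintype ι) (F : ι → MvPolynomial (Fin m) k),
      (∀ p : MvPolynomial (Fin m) k, p.IsHomogeneous 2 →
        aeval (fun a => (b a : A)) p = 0 → ∃ c : ι → k, p = ∑ l, c l • F l) ∧
      (∀ g : ι → MvPolynomial (Fin m) k, (∃ j ≤ 1, ∀ l, (g l).IsHomogeneous j) →
        ∑ l, g l * F l = 0 → ∀ l, g l = 0) := by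
  classical
  obtain ⟨N, π, fs, hsurj, hdeg, hhom, hreg, hker⟩ := h
  have := hstd.nontrivial
  choose E hE using fun l : Fin fs.length => hhom (fs.get l) (List.get_mem fs l)
  obtain ⟨f, hf⟩ : ∃ f : Fin fs.length → MvPolynomial (Fin N) k, f = fs.get := ⟨_, rfl⟩
  rw [← hf] at hE
  have hspanf : RingHom.ker π = Ideal.span (Set.range f) := by
    rw [hker, hf]
    exact congrArg Ideal.span (Set.ext fun x => (List.mem_iff_get.trans Iff.rfl))
  have hfπ : ∀ l, π (f l) = 0 := fun l => by
    rw [← RingHom.mem_ker, hspanf]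
    exact Ideal.subset_span ⟨l, rfl⟩
  have hf0 : ∀ l, E l = 0 → f l = 0 := by
    intro l hl
    have h1 := hE l
    rw [hl, ← totalDegree_zero_iff_isHomogeneous, totalDegree_eq_zero_iff_eq_C] at h1
    have h2 := hfπ l
    rw [h1] at h2 ⊢
    have h3 : algebraMap k A (coeff 0 (f l)) = 0 := by
      rw [← h2, ← algebraMap_eq, AlgHom.commutes]
    rw [(map_eq_zero _).1 h3, map_zero]
  -- Coefficients expressing a homogeneous element of the ideal may be replaced by their homogeneous
  -- parts of the complementary degrees.
  have hexpr : ∀ d p, p.IsHomogeneous d → π p = 0 → ∃ g : Fin fs.length → MvPolynomial (Fin N) k,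
      p = ∑ l, g l * f l ∧ ∀ l, (E l ≤ d → (g l).IsHomogeneous (d - E l)) ∧
        (d < E l → g l = 0) := by
    intro d p hp hp0
    rw [← RingHom.mem_ker, hspanf, Ideal.mem_span_range_iff_exists_fun] at hp0
    obtain ⟨g, hg⟩ := hp0
    refine ⟨fun l => if E l ≤ d then homogeneousComponent (d - E l) (g l) else 0, ?_, fun l =>
      ⟨fun hl => ?_, fun hl => if_neg (by omega)⟩⟩
    · rw [← homogeneousComponent_eq_self hp, ← hg, map_sum]
      refine Finset.sum_congr rfl fun l _ => ?_
      rw [homogeneousComponent_mul_of_isHomogeneous (hE l), ite_mul, zero_mul]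
    · simp only [if_pos hl]
      exact homogeneousComponent_isHomogeneous _ _
  let ψ : MvPolynomial (Fin m) k →ₐ[k] A := aeval fun a => (b a : A)
  let y : Fin N → 𝒜 1 := fun i => ⟨π (X i), hdeg 1 _ (isHomogeneous_X k i)⟩
  -- The given presentation may contain redundant variables, that is, linear forms among the `f l`.
  -- The map `ρ` eliminates them.
  let ρ : MvPolynomial (Fin N) k →ₐ[k] MvPolynomial (Fin m) k :=
    aeval fun i => ∑ a, b.repr (y i) a • X a
  have hρdeg : ∀ d p, p.IsHomogeneous d → (ρ p).IsHomogeneous d := by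
    intro d p hp
    have := hp.aeval (fun i => ∑ a, b.repr (y i) a • (X a : MvPolynomial (Fin m) k)) (n := 1)
      fun i => IsHomogeneous.sum _ _ _ fun a _ => by
        rw [MvPolynomial.smul_eq_C_mul]; exact (isHomogeneous_X k a).C_mul _
    rwa [one_mul] at this
  have hψρ : ∀ p, ψ (ρ p) = π p := by
    intro p
    refine DFunLike.congr_fun (algHom_ext (f := ψ.comp ρ) (g := π) fun i => ?_) p
    have h1 := congrArg Subtype.val (b.sum_repr (y i))
    rw [AddSubmonoidClass.coe_finsetSum] at h1
    simpa [ρ, ψ] using h1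
  have hψ : ∀ j ≤ 1, ∀ p : MvPolynomial (Fin m) k, p.IsHomogeneous j → ψ p = 0 → p = 0 := by
    intro j hj p hp hp0
    rcases Nat.le_one_iff_eq_zero_or_eq_one.1 hj with rfl | rfl
    · rw [← totalDegree_zero_iff_isHomogeneous, totalDegree_eq_zero_iff_eq_C] at hp
      rw [hp] at hp0 ⊢
      have h3 : algebraMap k A (coeff 0 p) = 0 := by
        rw [← hp0, ← algebraMap_eq, AlgHom.commutes]
      rw [(map_eq_zero _).1 h3, map_zero]
    · rw [← mem_homogeneousSubmodule, homogeneousSubmodule_one_eq_span_X,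
        Submodule.mem_span_range_iff_exists_fun] at hp
      obtain ⟨c, rfl⟩ := hp
      have h1 : ∑ a, c a • b a = 0 := by
        apply Subtype.ext
        simpa [ψ] using hp0
      have h2 := Fintype.linearIndependent_iff.1 b.linearIndependent c h1
      simp [h2]
  choose s hs hsπ using fun a => hstd.exists_homogeneous_lift π hsurj hdeg (b a).2
  let σ : MvPolynomial (Fin m) k →ₐ[k] MvPolynomial (Fin N) k := aeval s
  have hρσ : ∀ p, ρ (σ p) = p := by
    intro p
    refine DFunLike.congr_fun (algHom_ext (f := ρ.comp σ) (g := AlgHom.id k _) fun a => ?_) p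
    rw [← sub_eq_zero]
    refine hψ 1 le_rfl _ ?_ ?_
    · refine IsHomogeneous.sub ?_ (isHomogeneous_X k a)
      simpa [σ] using hρdeg 1 _ (hs a)
    · rw [map_sub, AlgHom.comp_apply, hψρ]
      simp [σ, ψ, hsπ]
  have hπσ : ∀ p, π (σ p) = ψ p := fun p => by rw [← hψρ, hρσ]
  -- The kernel of `ρ` is generated by linear `f l`: modulo these, `σ ∘ ρ` fixes every variable,
  -- because `σ (ρ (X i)) - X i` is a linear form killed by `π`.
  have hker' : ∀ p, ρ p = 0 → ∃ c : Fin fs.length → MvPolynomial (Fin N) k,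
      p = ∑ l, (if E l = 1 then c l else 0) * f l := by
    intro p hp
    set I : Ideal (MvPolynomial (Fin N) k) :=
      Ideal.span (Set.range fun l => if E l = 1 then f l else 0) with hI
    have h1 : (Ideal.Quotient.mkₐ k I).comp (σ.comp ρ) = Ideal.Quotient.mkₐ k I := by
      refine algHom_ext fun i => ?_
      simp only [AlgHom.comp_apply, Ideal.Quotient.mkₐ_eq_mk]
      rw [Ideal.Quotient.eq]
      have h2 : (σ (ρ (X i)) - X i : MvPolynomial (Fin N) k).IsHomogeneous 1 := by
        refine IsHomogeneous.sub ?_ (isHomogeneous_X k i)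
        have := (hρdeg 1 _ (isHomogeneous_X k i)).aeval s (n := 1) hs
        rwa [one_mul] at this
      obtain ⟨g, hg, hg'⟩ := hexpr 1 _ h2 (by rw [map_sub, hπσ, hψρ, sub_self])
      rw [hg]
      refine Ideal.sum_mem _ fun l _ => ?_
      rcases Nat.lt_trichotomy (E l) 1 with hl | hl | hl
      · rw [hf0 l (by omega), mul_zero]; exact Ideal.zero_mem _
      · exact Ideal.mul_mem_left _ _ (Ideal.subset_span ⟨l, if_pos hl⟩)
      · rw [(hg' l).2 hl, zero_mul]; exact Ideal.zero_mem _
    have h2 := DFunLike.congr_fun h1 p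
    simp only [AlgHom.comp_apply, Ideal.Quotient.mkₐ_eq_mk, hp, map_zero] at h2
    have h3 : p ∈ I := Ideal.Quotient.eq_zero_iff_mem.1 h2.symm
    obtain ⟨c, hc⟩ := Ideal.mem_span_range_iff_exists_fun.1 h3
    refine ⟨c, ?_⟩
    rw [← hc]
    exact Finset.sum_congr rfl fun l _ => by split_ifs <;> simp
  refine ⟨{l // E l = 2}, inferInstance, fun l => ρ (f l), ?_, ?_⟩
  · intro p hp hp0
    have h2 : (σ p).IsHomogeneous 2 := by
      have := hp.aeval s (n := 1) hs
      rwa [one_mul] at this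
    obtain ⟨g, hg, hg'⟩ := hexpr 2 _ h2 (by rw [hπσ]; exact hp0)
    refine ⟨fun l => coeff 0 (g l), ?_⟩
    rw [Finset.sum_subtype_eq_sum_dite]
    conv_lhs => rw [← hρσ p, hg, map_sum]
    refine Finset.sum_congr rfl fun l _ => ?_
    rw [map_mul]
    split_ifs with hl
    · have h3 := (hg' l).1 hl.le
      rw [hl, Nat.sub_self, ← totalDegree_zero_iff_isHomogeneous,
        totalDegree_eq_zero_iff_eq_C] at h3
      rw [h3, ← algebraMap_eq, AlgHom.commutes, algebraMap_eq, ← MvPolynomial.smul_eq_C_mul]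
    · rcases lt_or_ge 2 (E l) with h3 | h3
      · rw [(hg' l).2 h3, map_zero, zero_mul]
      · rw [hψ (E l) (by omega) (ρ (f l)) (hρdeg _ _ (hE l)) (by rw [hψρ, hfπ]), mul_zero]
  · rintro g ⟨j, hj, hgj⟩ hg l
    obtain ⟨c, hc⟩ := hker' (∑ l : {l // E l = 2}, σ (g l) * f l) (by
      rw [map_sum, ← hg]
      exact Finset.sum_congr rfl fun l _ => by rw [map_mul, hρσ])
    rw [Finset.sum_subtype_eq_sum_dite] at hc
    refine hψ j hj _ (hgj l) ?_
    -- The lifted syzygy, corrected by the linear `f l`, is a relation on the whole regular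
    -- sequence. Its coefficients lie in the ideal, so `g l` vanishes in `A`, and `ψ` is injective
    -- in degrees at most one.
    have h1 := mem_ofList_of_sum_mul_get_eq_zero hreg.toIsWeaklyRegular
      (fun l => (if h : E l = 2 then σ (g ⟨l, h⟩) else 0) - if E l = 1 then c l else 0) ?_ l
    · rw [← hker, RingHom.mem_ker] at h1
      have h2 : ¬ E l = 1 := by rw [l.2]; omega
      simpa [l.2, h2, hπσ] using h1
    · rw [← hf]
      simp only [sub_mul, Finset.sum_sub_distrib]
      rw [← hc, sub_eq_zero]
      exact Finset.sum_congr rfl fun l _ => by split_ifs <;> simp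

end GradedAlgebras

/-! ### Minimal resolutions and their linear strand -/

section Standard

variable {k A : Type*} [Field k] [CommRing A] [Algebra k A] {𝒜 : ℕ → Submodule k A}

theorem IsStandardGraded.decompose_zero_of_mem_irrelevantIdeal (h : IsStandardGraded 𝒜) {x : A}
    (hx : x ∈ irrelevantIdeal 𝒜) :
    letI := h.gradedAlgebra
    (DirectSum.decompose 𝒜 x 0 : A) = 0 := by
  let := h.gradedAlgebra
  have hle : irrelevantIdeal 𝒜 ≤ RingHom.ker (GradedRing.projZeroRingHom 𝒜) := by
    refine Ideal.span_le.2 ?_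
    rintro y ⟨i, hi, hy⟩
    exact DirectSum.decompose_of_mem_ne 𝒜 hy hi.ne'
  exact hle hx

theorem IsStandardGraded.eq_zero_of_mem_zero (h : IsStandardGraded 𝒜) {x : A} (hx : x ∈ 𝒜 0)
    (hx' : x ∈ irrelevantIdeal 𝒜) : x = 0 := by
  let := h.gradedAlgebra
  rw [← DirectSum.decompose_of_mem_same 𝒜 hx]
  exact h.decompose_zero_of_mem_irrelevantIdeal hx'

end Standard

namespace MinimalGradedFreeResolution

variable {k A M : Type*} [Field k] [CommRing A] [Algebra k A] {𝒜 : ℕ → Submodule k A}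
  [AddCommGroup M] [Module k M] [Module A M] {ℳ : ℕ → Submodule k M}
  (F : MinimalGradedFreeResolution 𝒜 ℳ)

theorem d_apply (i : ℕ) (v : Fin (F.rank (i + 1)) → A) (a : Fin (F.rank i)) :
    F.d i v a = ∑ b, v b * F.d i (Pi.single b 1) a := by
  classical
  rw [LinearMap.pi_apply_eq_sum_univ (F.d i) v, Finset.sum_apply]
  refine Finset.sum_congr rfl fun b _ => ?_
  rw [Pi.smul_apply, smul_eq_mul]
  have h : (fun j => if b = j then (1 : A) else 0) = Pi.single b 1 := by
    ext c
    simp [Pi.single_apply, eq_comm]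
  rw [h]

theorem aug_apply (v : Fin (F.rank 0) → A) :
    F.aug v = ∑ b, v b • F.aug (Pi.single b 1) := by
  classical
  rw [LinearMap.pi_apply_eq_sum_univ F.aug v]
  refine Finset.sum_congr rfl fun b _ => ?_
  congr 3
  ext c
  simp [Pi.single_apply, eq_comm]

theorem d_mem_irrelevantIdeal (i : ℕ) (v : Fin (F.rank (i + 1)) → A) (a : Fin (F.rank i)) :
    F.d i v a ∈ irrelevantIdeal 𝒜 := by
  rw [d_apply]
  exact Ideal.sum_mem _ fun b _ => Ideal.mul_mem_left _ _ (F.d_minimal i b a)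

theorem mem_irrelevantIdeal_of_aug_eq_zero {v : Fin (F.rank 0) → A} (hv : F.aug v = 0)
    (a : Fin (F.rank 0)) : v a ∈ irrelevantIdeal 𝒜 := by
  obtain ⟨w, rfl⟩ := (F.exact_zero v).1 hv
  exact F.d_mem_irrelevantIdeal 0 w a

theorem mem_irrelevantIdeal_of_d_eq_zero {i : ℕ} {v : Fin (F.rank (i + 1)) → A}
    (hv : F.d i v = 0) (a : Fin (F.rank (i + 1))) : v a ∈ irrelevantIdeal 𝒜 := by
  obtain ⟨w, rfl⟩ := (F.exact_succ i v).1 hv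
  exact F.d_mem_irrelevantIdeal (i + 1) w a

/-- A minimal free cover of a cyclic module has rank one. -/
theorem eq_of_aug_generates (h1 : (1 : A) ∉ irrelevantIdeal 𝒜) {a : Fin (F.rank 0)}
    (ha : ∀ y : M, ∃ x : A, x • F.aug (Pi.single a 1) = y) (b : Fin (F.rank 0)) : b = a := by
  classical
  by_contra hab
  obtain ⟨x, hx⟩ := ha (F.aug (Pi.single b 1))
  have h := F.mem_irrelevantIdeal_of_aug_eq_zero (v := Pi.single b 1 - x • Pi.single a 1)
    (by rw [map_sub, map_smul, hx, sub_self]) b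
  simp [hab] at h
  exact h1 h

/-- Such an entry is zero by homogeneity or has degree `0`, and minimality excludes nonzero
constants. -/
theorem entry_eq_zero (h0 : ∀ x ∈ 𝒜 0, x ∈ irrelevantIdeal 𝒜 → x = 0) {i : ℕ}
    {b : Fin (F.rank (i + 1))} {a : Fin (F.rank i)} (h : F.shift (i + 1) b ≤ F.shift i a) :
    F.d i (Pi.single b 1) a = 0 := by
  rcases F.d_homogeneous i b a with ⟨h1, h2⟩ | h2
  · rw [le_antisymm h h1, Nat.sub_self] at h2
    exact h0 _ h2 (F.d_minimal i b a)
  · exact h2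

theorem d_single_ne_zero (h1 : (1 : A) ∉ irrelevantIdeal 𝒜) (i : ℕ) (b : Fin (F.rank (i + 1))) :
    F.d i (Pi.single b 1) ≠ 0 := by
  intro h
  have := F.mem_irrelevantIdeal_of_d_eq_zero h b
  rw [Pi.single_eq_same] at this
  exact h1 this

theorem exists_shift_lt (h0 : ∀ x ∈ 𝒜 0, x ∈ irrelevantIdeal 𝒜 → x = 0)
    (h1 : (1 : A) ∉ irrelevantIdeal 𝒜) (i : ℕ) (b : Fin (F.rank (i + 1))) :
    ∃ a, F.shift i a < F.shift (i + 1) b := by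
  by_contra! h
  exact F.d_single_ne_zero h1 i b (funext fun a => F.entry_eq_zero h0 (h a))

theorem le_shift (h0 : ∀ x ∈ 𝒜 0, x ∈ irrelevantIdeal 𝒜 → x = 0)
    (h1 : (1 : A) ∉ irrelevantIdeal 𝒜) (i : ℕ) (b : Fin (F.rank i)) : i ≤ F.shift i b := by
  induction i with
  | zero => exact Nat.zero_le _
  | succ i ih =>
    obtain ⟨a, ha⟩ := F.exists_shift_lt h0 h1 i b
    exact (Nat.succ_le_succ (ih a)).trans ha

theorem aug_eq_zero_of_residue (F : MinimalGradedFreeResolution 𝒜 (residueGrading 𝒜)) {q : ℕ}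
    (hq : 0 < q) {v : Fin (F.rank 0) → A} (hv : ∀ b, F.shift 0 b = 0 → v b ∈ 𝒜 q) :
    F.aug v = 0 := by
  rw [F.aug_apply]
  refine Finset.sum_eq_zero fun b _ => ?_
  by_cases hb : F.shift 0 b = 0
  · obtain ⟨x, hx⟩ := Ideal.Quotient.mk_surjective (F.aug (Pi.single b 1))
    rw [← hx, ← Ideal.Quotient.mk_eq_mk, ← Submodule.Quotient.mk_smul,
      Submodule.Quotient.mk_eq_zero, smul_eq_mul]
    exact Ideal.mul_mem_right _ _ (Ideal.subset_span ⟨q, hq, hv b hb⟩)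
  · have h1 := F.aug_homogeneous b
    unfold residueGrading at h1
    rw [if_neg hb, Submodule.mem_bot] at h1
    rw [h1, smul_zero]

theorem rank_zero_of_residue (F : MinimalGradedFreeResolution 𝒜 (residueGrading 𝒜))
    (h1 : (1 : A) ∉ irrelevantIdeal 𝒜)
    (hgen : ∀ x, x ∉ irrelevantIdeal 𝒜 → ∀ y, ∃ r, r * x - y ∈ irrelevantIdeal 𝒜) :
    F.rank 0 = 1 := by
  have hne : Nonempty (Fin (F.rank 0)) := by
    by_contra hemp
    rw [not_nonempty_iff] at hemp
    obtain ⟨v, hv⟩ := F.aug_surjective (Ideal.Quotient.mk _ 1)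
    rw [F.aug_apply, Finset.univ_eq_empty, Finset.sum_empty, eq_comm,
      Ideal.Quotient.eq_zero_iff_mem] at hv
    exact h1 hv
  obtain ⟨a⟩ := hne
  have hgen : ∀ y, ∃ x : A, x • F.aug (Pi.single a 1) = y := by
    intro y
    obtain ⟨y, rfl⟩ := Ideal.Quotient.mk_surjective y
    obtain ⟨x, hx⟩ := Ideal.Quotient.mk_surjective (F.aug (Pi.single a 1))
    obtain ⟨r, hr⟩ := hgen x (fun h => by
      have h2 : F.aug (Pi.single a 1) = 0 := by
        rw [← hx, Ideal.Quotient.eq_zero_iff_mem]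
        exact h
      have h3 := F.mem_irrelevantIdeal_of_aug_eq_zero h2 a
      rw [Pi.single_eq_same] at h3
      exact h1 h3) y
    refine ⟨r, ?_⟩
    rw [← hx, ← Ideal.Quotient.mk_eq_mk, ← Submodule.Quotient.mk_smul, Ideal.Quotient.mk_eq_mk,
      Ideal.Quotient.eq]
    exact hr
  have h2 := F.eq_of_aug_generates h1 hgen
  have : Fintype.card (Fin (F.rank 0)) = 1 := Fintype.card_eq_one_iff.2 ⟨a, h2⟩
  simpa using this

/-- The number of basis elements of degree `i + e` in step `i`. -/
def bettiDiag (e i : ℕ) : ℕ :=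
  (Finset.univ.filter fun b : Fin (F.rank i) => F.shift i b = i + e).card

/-- The linear strand of a minimal resolution over a graded complete intersection has polynomial
growth. -/
theorem polyGrowth_bettiDiag (hstd : IsStandardGraded 𝒜) (hCI : IsGradedCompleteIntersection 𝒜) :
    PolyGrowth (F.bettiDiag 0) := by
  classical
  have := hstd.nontrivial
  have h0 : ∀ x ∈ 𝒜 0, x ∈ irrelevantIdeal 𝒜 → x = 0 := fun x hx hx' =>
    hstd.eq_zero_of_mem_zero hx hx'
  have hA0 : ∀ c : k, algebraMap k A c ∈ 𝒜 0 := fun c => by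
    rw [hstd.zero_eq]
    exact Submodule.algebraMap_mem c
  have h1 : (1 : A) ∉ irrelevantIdeal 𝒜 := fun h => one_ne_zero (h0 1 (by simpa using hA0 1) h)
  have := hstd.finite_one
  let e := Module.finBasis k (𝒜 1)
  set m := Module.finrank k (𝒜 1)
  obtain ⟨ι, _, Q, hspan, hsyz⟩ := hCI.exists_quadrics hstd e
  -- The coordinate functionals of degree one are extended to all of `A`, so that they can be
  -- applied to matrix entries without carrying membership proofs.
  choose κ hκ using fun a => (e.coord a).exists_extend
  have hκ' : ∀ x ∈ 𝒜 1, x = ∑ a, algebraMap k A (κ a x) * e a := by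
    intro x hx
    have h2 := congrArg Subtype.val (e.sum_repr ⟨x, hx⟩)
    rw [AddSubmonoidClass.coe_finsetSum] at h2
    rw [← show _ = x from h2]
    refine Finset.sum_congr rfl fun a _ => ?_
    have h3 := LinearMap.congr_fun (hκ a) ⟨x, hx⟩
    rw [← Algebra.smul_def]
    simp only [LinearMap.comp_apply, Submodule.subtype_apply] at h3
    rw [show (∑ i, ((e.repr ⟨x, hx⟩) i • e i : 𝒜 1) : A) = x from h2, h3]
    rfl
  let coef (i : ℕ) (a : Fin m) (b' : Fin (F.rank i)) (b : Fin (F.rank (i + 1))) : k :=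
    if F.shift (i + 1) b = i + 1 ∧ F.shift i b' = i then κ a (F.d i (Pi.single b 1) b') else 0
  let x (a : Fin m) : Module.End k (∀ i : ℕ, Fin (F.rank i) → k) :=
    { toFun := fun v i b' => ∑ b, coef i a b' b * v (i + 1) b
      map_add' := fun v w => by
        ext i b'
        simp [mul_add, Finset.sum_add_distrib]
      map_smul' := fun c v => by
        ext i b'
        simp [Finset.mul_sum, mul_left_comm] }
  have hxdef : ∀ a v i b', x a v i b' = ∑ b, coef i a b' b * v (i + 1) b := fun _ _ _ _ => rfl
  have hx0 : ∀ a v i b', F.shift i b' ≠ i → x a v i b' = 0 := fun a v i b' hb => by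
    rw [hxdef]
    exact Finset.sum_eq_zero fun b _ => by simp [coef, hb]
  -- On constant vectors in the linear strand the differential is `∑ a, x a ⊗ e a`. Entries into
  -- generators outside the strand vanish, since those have degree at least `i + 1`.
  have hd : ∀ i (v : ∀ i : ℕ, Fin (F.rank i) → k),
      (∀ b, F.shift (i + 1) b ≠ i + 1 → v (i + 1) b = 0) →
      ∀ b', F.d i (fun b => algebraMap k A (v (i + 1) b)) b' =
        ∑ a, algebraMap k A (x a v i b') * e a := by
    intro i v hv b'
    rw [d_apply]
    have : ∀ b, algebraMap k A (v (i + 1) b) * F.d i (Pi.single b 1) b' =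
        ∑ a, algebraMap k A (coef i a b' b * v (i + 1) b) * e a := by
      intro b
      by_cases hb : F.shift (i + 1) b = i + 1
      · by_cases hb' : F.shift i b' = i
        · have h2 : F.d i (Pi.single b 1) b' ∈ 𝒜 1 := by
            rcases F.d_homogeneous i b b' with ⟨-, h3⟩ | h3
            · rwa [hb, hb', Nat.add_sub_cancel_left] at h3
            · rw [h3]; exact Submodule.zero_mem _
          conv_lhs => rw [hκ' _ h2]
          rw [Finset.mul_sum]
          refine Finset.sum_congr rfl fun a _ => ?_
          simp only [coef, hb, hb', and_self, if_true, map_mul]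
          ring
        · rw [F.entry_eq_zero h0, mul_zero]
          · exact (Finset.sum_eq_zero fun a _ => by simp [coef, hb']).symm
          · have := F.le_shift h0 h1 i b'
            omega
      · simp [hv b hb]
    rw [Finset.sum_congr rfl fun b _ => this b, Finset.sum_comm]
    refine Finset.sum_congr rfl fun a _ => ?_
    rw [hxdef, map_sum, Finset.sum_mul]
  let G (i : ℕ) : Submodule k (∀ i : ℕ, Fin (F.rank i) → k) :=
    { carrier := {v | ∀ j b, (j ≠ i ∨ F.shift j b ≠ j) → v j b = 0}
      add_mem' := fun {v w} hv hw j b h => by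
        simp [hv j b h, hw j b h]
      zero_mem' := fun _ _ _ => rfl
      smul_mem' := fun c v hv j b h => by simp [hv j b h] }
  have hG : ∀ i v, v ∈ G i ↔ ∀ j b, (j ≠ i ∨ F.shift j b ≠ j) → v j b = 0 := fun _ _ => Iff.rfl
  let ev (i : ℕ) : G i ≃ₗ[k] ({b : Fin (F.rank i) // F.shift i b = i} → k) :=
    { toFun := fun v b => v.1 i b
      map_add' := fun _ _ => rfl
      map_smul' := fun _ _ => rfl
      invFun := fun w => ⟨fun j b => if h : j = i ∧ F.shift j b = j then
          w ⟨h.1 ▸ b, by obtain ⟨rfl, h⟩ := h; exact h⟩ else 0, fun j b h => by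
            simp only
            rw [dif_neg (by tauto)]⟩
      left_inv := fun v => by
        ext j b
        by_cases h : j = i ∧ F.shift j b = j
        · obtain ⟨rfl, h⟩ := h
          simp [h]
        · simp only [h, dite_false]
          exact (v.2 j b (by tauto)).symm
      right_inv := fun w => by
        ext b
        simp [b.2] }
  have hfin : ∀ i, FiniteDimensional k (G i) := fun i => (ev i).symm.finiteDimensional
  have hcard : ∀ i, Module.finrank k (G i) = F.bettiDiag 0 i := fun i => by
    rw [(ev i).finrank_eq, Module.finrank_fintype_fun_eq_card, Fintype.card_subtype]
    rfl
  refine (congrArg PolyGrowth (funext hcard)).mp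
    (polyGrowth_of_no_linear_syzygies x G ?_ ?_ (fun a => (e a : A)) ?_ Q hspan hsyz)
  · intro a i v hv j b hj
    rcases hj with hj | hj
    · rw [hxdef]
      exact Finset.sum_eq_zero fun b' _ => by rw [hv _ _ (Or.inl (by omega)), mul_zero]
    · exact hx0 a v j b hj
  -- A constant vector killed by the differential has entries in the irrelevant ideal by minimality,
  -- hence is zero.
  · intro i v hv hxv
    have h2 : F.d i (fun b => algebraMap k A (v (i + 1) b)) = 0 := by
      ext b'
      rw [hd i v (fun b hb => hv _ b (Or.inr hb))]
      simp [hxv]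
    ext j b
    by_cases hj : j = i + 1
    · subst hj
      have h3 := h0 _ (hA0 _) (F.mem_irrelevantIdeal_of_d_eq_zero h2 b)
      exact (map_eq_zero _).1 h3
    · exact hv j b (Or.inl hj)
  -- The dual relations are `d ∘ d = 0` on the linear strand, expanded in the products `e a * e b`
  -- and evaluated by `μ`.
  · intro μ v
    ext i b
    by_cases hb : F.shift i b = i
    swap
    · simp [Finset.sum_apply, hx0 _ _ _ _ hb]
    -- `v` is arbitrary here while `hd` needs support in the linear strand; the `x a` do not see the
    -- discarded part.
    let v' : ∀ i : ℕ, Fin (F.rank i) → k := fun j b => if F.shift j b = j then v j b else 0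
    have hv' : ∀ a, x a v' = x a v := fun a => by
      ext j b'
      rw [hxdef, hxdef]
      refine Finset.sum_congr rfl fun b _ => ?_
      by_cases h : F.shift (j + 1) b = j + 1 <;> simp [coef, v', h]
    have h2 := hd (i + 1) v' fun b hb => if_neg hb
    simp only [hv'] at h2
    have h3 : F.d i (F.d (i + 1) fun b => algebraMap k A (v' (i + 1 + 1) b)) = 0 :=
      (F.exact_succ i).apply_apply_eq_zero _
    have h4 : (F.d (i + 1) fun b => algebraMap k A (v' (i + 1 + 1) b)) =
        ∑ a, (e a : A) • fun b' => algebraMap k A (x a v (i + 1) b') := by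
      ext b'
      rw [h2, Finset.sum_apply]
      exact Finset.sum_congr rfl fun a _ => mul_comm _ _
    rw [h4, map_sum] at h3
    have h5 := congrArg μ (congrFun h3 b)
    rw [Finset.sum_apply, map_sum] at h5
    simp only [Finset.sum_apply, Pi.smul_apply, Pi.zero_apply, smul_eq_mul]
    rw [← map_zero μ, ← show _ = μ 0 from h5]
    refine Finset.sum_congr rfl fun a _ => ?_
    rw [map_smul, Pi.smul_apply, hd i (x a v) (fun b hb => hx0 a v _ b hb), smul_eq_mul,
      Finset.mul_sum, map_sum]
    refine Finset.sum_congr rfl fun c _ => ?_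
    rw [mul_left_comm, ← Algebra.smul_def, map_smul, smul_eq_mul, mul_comm]

end MinimalGradedFreeResolution

/-! ### The irrelevant ideal of a Veronese subring -/

section VeroneseBasic

variable {k : Type*} [Field k] {n c : ℕ}

theorem mem_veroneseSubring_of_isHomogeneous {p : MvPolynomial (Fin n) k} {i : ℕ}
    (hp : p.IsHomogeneous (c * i)) : p ∈ veroneseSubring k n c := by
  intro m hm
  have h := hp.degree_eq_sum_deg_support hm
  exact ⟨i, by rw [h]; rfl⟩

theorem mem_veroneseGrading_iff {i : ℕ} {x : veroneseSubring k n c} :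
    x ∈ veroneseGrading k n c i ↔ (x : MvPolynomial (Fin n) k).IsHomogeneous (c * i) :=
  Iff.rfl

theorem constantCoeff_of_mem_irrelevantIdeal (hc : 0 < c) {x : veroneseSubring k n c}
    (hx : x ∈ irrelevantIdeal (veroneseGrading k n c)) :
    MvPolynomial.constantCoeff (x : MvPolynomial (Fin n) k) = 0 := by
  have hle : irrelevantIdeal (veroneseGrading k n c) ≤
      RingHom.ker ((MvPolynomial.constantCoeff (R := k) (σ := Fin n)).comp
        (veroneseSubring k n c).val.toRingHom) := by
    refine Ideal.span_le.2 ?_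
    rintro y ⟨i, hi, hy⟩
    have hy' := mem_veroneseGrading_iff.1 hy
    exact hy'.coeff_eq_zero (by
      rw [map_zero]
      exact (Nat.mul_pos hc hi).ne)
  exact hle hx

theorem mem_irrelevantIdeal_of_constantCoeff {x : veroneseSubring k n c}
    (hx : MvPolynomial.constantCoeff (x : MvPolynomial (Fin n) k) = 0) :
    x ∈ irrelevantIdeal (veroneseGrading k n c) := by
  classical
  have hmem : ∀ j, MvPolynomial.homogeneousComponent j (x : MvPolynomial (Fin n) k) ∈
      veroneseSubring k n c := by
    intro j m hm
    rw [MvPolynomial.support_homogeneousComponent] at hm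
    exact x.2 m (Finset.mem_filter.1 hm).1
  have hsum : x = ∑ j ∈ Finset.range ((x : MvPolynomial (Fin n) k).totalDegree + 1),
      (⟨_, hmem j⟩ : veroneseSubring k n c) := by
    apply Subtype.ext
    rw [AddSubmonoidClass.coe_finsetSum, MvPolynomial.sum_homogeneousComponent]
  rw [hsum]
  refine Ideal.sum_mem _ fun j _ => ?_
  by_cases hz : MvPolynomial.homogeneousComponent j (x : MvPolynomial (Fin n) k) = 0
  · rw [show (⟨_, hmem j⟩ : veroneseSubring k n c) = 0 from Subtype.ext hz]
    exact Ideal.zero_mem _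
  · obtain ⟨m, hm⟩ := MvPolynomial.ne_zero_iff.1 hz
    have hm' := MvPolynomial.mem_support_iff.2 hm
    obtain ⟨i, hi⟩ := hmem j m hm'
    rw [MvPolynomial.support_homogeneousComponent] at hm'
    have hj := (Finset.mem_filter.1 hm').2
    refine Ideal.subset_span ⟨i, ?_, mem_veroneseGrading_iff.2 ?_⟩
    · rcases Nat.eq_zero_or_pos i with rfl | h
      · exfalso
        rw [mul_zero] at hi
        rw [← hj, hi] at hz
        rw [MvPolynomial.homogeneousComponent_zero] at hz
        exact hz (by rw [← MvPolynomial.constantCoeff_eq, hx, map_zero])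
      · exact h
    · rw [← hi, hj]
      exact MvPolynomial.homogeneousComponent_isHomogeneous _ _

theorem veronese_eq_zero_of_mem_zero (hc : 0 < c) (x : veroneseSubring k n c)
    (hx : x ∈ veroneseGrading k n c 0) (hx' : x ∈ irrelevantIdeal (veroneseGrading k n c)) :
    x = 0 := by
  have h1 := mem_veroneseGrading_iff.1 hx
  rw [mul_zero, ← MvPolynomial.totalDegree_zero_iff_isHomogeneous,
    MvPolynomial.totalDegree_eq_zero_iff_eq_C, ← MvPolynomial.constantCoeff_eq,
    constantCoeff_of_mem_irrelevantIdeal hc hx', map_zero] at h1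
  exact Subtype.ext h1

theorem veronese_one_notMem (hc : 0 < c) :
    (1 : veroneseSubring k n c) ∉ irrelevantIdeal (veroneseGrading k n c) := fun h => by
  have := constantCoeff_of_mem_irrelevantIdeal hc h
  simp at this

end VeroneseBasic

/-! ### Killing variables in graded pieces of the polynomial ring -/

section Truncation

open MvPolynomial

variable (k : Type*) [Field k] (n : ℕ)

/-- The endomorphism of `k[x_1, …, x_n]` that kills the first `s` variables. -/
noncomputable def killVars (s : ℕ) : MvPolynomial (Fin n) k →ₐ[k] MvPolynomial (Fin n) k :=
  aeval fun i => if i.val < s then 0 else X i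

variable {k n}

theorem killVars_X (s : ℕ) (i : Fin n) :
    killVars k n s (X i) = if i.val < s then 0 else X i := by
  simp [killVars]

theorem killVars_zero (p : MvPolynomial (Fin n) k) : killVars k n 0 p = p := by
  refine DFunLike.congr_fun (algHom_ext (g := AlgHom.id k _) fun i => ?_) p
  simp [killVars_X]

theorem killVars_killVars {s t : ℕ} (h : s ≤ t) (p : MvPolynomial (Fin n) k) :
    killVars k n t (killVars k n s p) = killVars k n t p := by
  refine DFunLike.congr_fun (algHom_ext (f := (killVars k n t).comp (killVars k n s))
    (g := killVars k n t) fun i => ?_) p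
  simp only [AlgHom.comp_apply, killVars_X]
  by_cases hi : i.val < s
  · simp [hi, hi.trans_le h]
  · simp [hi, killVars_X]

theorem killVars_killVars' {s t : ℕ} (h : s ≤ t) (p : MvPolynomial (Fin n) k) :
    killVars k n s (killVars k n t p) = killVars k n t p := by
  refine DFunLike.congr_fun (algHom_ext (f := (killVars k n s).comp (killVars k n t))
    (g := killVars k n t) fun i => ?_) p
  simp only [AlgHom.comp_apply, killVars_X]
  by_cases hi : i.val < t
  · simp [hi]
  · have : ¬ i.val < s := by omega
    simp [hi, this, killVars_X]

theorem killVars_all (p : MvPolynomial (Fin n) k) :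
    killVars k n n p = C (constantCoeff p) := by
  refine DFunLike.congr_fun (algHom_ext (f := killVars k n n)
    (g := (Algebra.ofId k _).comp (aeval (fun _ => (0 : k)))) fun i => ?_) p |>.trans ?_
  · simp [killVars_X]
  · simp [Algebra.ofId_apply, constantCoeff_eq, algebraMap_eq]

theorem killVars_isHomogeneous (s : ℕ) {p : MvPolynomial (Fin n) k} {d : ℕ}
    (hp : p.IsHomogeneous d) : (killVars k n s p).IsHomogeneous d := by
  have := hp.aeval (fun i : Fin n => if i.val < s then (0 : MvPolynomial (Fin n) k) else X i)
    (n := 1) fun i => by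
      split_ifs
      · exact isHomogeneous_zero _ _ _
      · exact isHomogeneous_X _ _
  rwa [one_mul] at this

/-- Modulo `X s`, killing the first `s` variables and killing the first `s + 1` are the same map. -/
theorem exists_eq_X_mul_of_killVars (s : Fin n) {p : MvPolynomial (Fin n) k}
    (h1 : killVars k n s p = p) (h2 : killVars k n (s + 1) p = 0) : ∃ q, p = q * X s := by
  have h : (Ideal.Quotient.mkₐ k (Ideal.span {(X s : MvPolynomial (Fin n) k)})).comp
      (killVars k n s) = (Ideal.Quotient.mkₐ k (Ideal.span {(X s : MvPolynomial (Fin n) k)})).comp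
      (killVars k n (s + 1)) := by
    refine algHom_ext fun i => ?_
    simp only [AlgHom.comp_apply, Ideal.Quotient.mkₐ_eq_mk, killVars_X]
    by_cases hi : i = s
    · subst hi
      simp
    · have : (i.val < s.val) ↔ i.val < s.val + 1 := by
        have : i.val ≠ s.val := fun h => hi (Fin.ext h)
        omega
      simp only [this]
  have h3 := DFunLike.congr_fun h p
  simp only [AlgHom.comp_apply, h1, h2, map_zero, Ideal.Quotient.mkₐ_eq_mk] at h3
  obtain ⟨q, hq⟩ := Ideal.mem_span_singleton.1 (Ideal.Quotient.eq_zero_iff_mem.1 h3)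
  exact ⟨q, by rw [hq, mul_comm]⟩

variable (k n)

/-- The polynomials that are homogeneous of degree `N - j` in case `j ≤ N`, and zero otherwise. -/
noncomputable def shiftedComponent (N j : ℕ) : Submodule k (MvPolynomial (Fin n) k) :=
  if j ≤ N then homogeneousSubmodule (Fin n) k (N - j) else ⊥

/-- The projection onto `shiftedComponent`. -/
noncomputable def shiftedProj (N j : ℕ) (p : MvPolynomial (Fin n) k) : MvPolynomial (Fin n) k :=
  if j ≤ N then homogeneousComponent (N - j) p else 0

variable {k n}

theorem shiftedProj_mem (N j : ℕ) (p : MvPolynomial (Fin n) k) :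
    shiftedProj k n N j p ∈ shiftedComponent k n N j := by
  unfold shiftedProj shiftedComponent
  split_ifs
  · exact homogeneousComponent_mem _ _
  · exact Submodule.zero_mem _

theorem shiftedProj_eq_self {N j : ℕ} {p : MvPolynomial (Fin n) k}
    (hp : p ∈ shiftedComponent k n N j) : shiftedProj k n N j p = p := by
  unfold shiftedComponent at hp
  unfold shiftedProj
  split_ifs at hp ⊢ with h
  · exact homogeneousComponent_eq_self hp
  · exact ((Submodule.mem_bot k).1 hp).symm

theorem shiftedProj_sum {ι : Type*} (s : Finset ι) (N j : ℕ) (f : ι → MvPolynomial (Fin n) k) :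
    shiftedProj k n N j (∑ i ∈ s, f i) = ∑ i ∈ s, shiftedProj k n N j (f i) := by
  unfold shiftedProj
  split_ifs
  · exact map_sum _ _ _
  · simp

theorem shiftedProj_mul {e : MvPolynomial (Fin n) k} {i j N : ℕ} (hij : i ≤ j)
    (he : e.IsHomogeneous (j - i)) (p : MvPolynomial (Fin n) k) :
    shiftedProj k n N i (e * p) = e * shiftedProj k n N j p := by
  unfold shiftedProj
  rw [mul_comm e p, homogeneousComponent_mul_of_isHomogeneous he, mul_comm e]
  by_cases h : j ≤ N
  · rw [if_pos (hij.trans h), if_pos h, if_pos (by omega), show N - i - (j - i) = N - j by omega]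
  · rw [if_neg h, zero_mul]
    by_cases h' : i ≤ N
    · rw [if_pos h', if_neg (by omega)]
    · rw [if_neg h']

theorem mul_mem_shiftedComponent {e p : MvPolynomial (Fin n) k} {i j N : ℕ} (hij : i ≤ j)
    (he : e.IsHomogeneous (j - i)) (hp : p ∈ shiftedComponent k n N j) :
    e * p ∈ shiftedComponent k n N i := by
  rw [← shiftedProj_eq_self hp, ← shiftedProj_mul hij he]
  exact shiftedProj_mem _ _ _

theorem killVars_mem_shiftedComponent (s : ℕ) {p : MvPolynomial (Fin n) k} {j N : ℕ}
    (hp : p ∈ shiftedComponent k n N j) : killVars k n s p ∈ shiftedComponent k n N j := by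
  unfold shiftedComponent at hp ⊢
  split_ifs at hp ⊢
  · exact killVars_isHomogeneous s hp
  · rw [(Submodule.mem_bot k).1 hp, map_zero]; exact Submodule.zero_mem _

theorem X_mul_mem_shiftedComponent (s : Fin n) {p : MvPolynomial (Fin n) k} {j N : ℕ}
    (hp : p ∈ shiftedComponent k n N j) : X s * p ∈ shiftedComponent k n (N + 1) j := by
  unfold shiftedComponent at hp ⊢
  by_cases h : j ≤ N
  · rw [if_pos h] at hp
    rw [if_pos (h.trans N.le_succ), show N + 1 - j = 1 + (N - j) by omega]
    exact (isHomogeneous_X k s).mul hp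
  · rw [if_neg h, Submodule.mem_bot] at hp
    rw [hp, mul_zero]
    exact Submodule.zero_mem _

theorem exists_X_mul_of_mem_shiftedComponent (s : Fin n) {p : MvPolynomial (Fin n) k} {j N : ℕ}
    (hp : p ∈ shiftedComponent k n (N + 1) j)
    (h1 : killVars k n s p = p) (h2 : killVars k n (s + 1) p = 0) :
    ∃ q ∈ shiftedComponent k n N j, killVars k n s q = q ∧ p = X s * q := by
  obtain ⟨q, hq⟩ := exists_eq_X_mul_of_killVars s h1 h2
  refine ⟨killVars k n s (shiftedProj k n N j q),
    killVars_mem_shiftedComponent s (shiftedProj_mem _ _ _), killVars_killVars le_rfl _, ?_⟩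
  have hX : killVars k n s (X s) = X s := by simp [killVars_X]
  rw [show X s * killVars k n s (shiftedProj k n N j q) =
    killVars k n s (X s * shiftedProj k n N j q) by rw [map_mul, hX]]
  conv_lhs => rw [← h1, ← shiftedProj_eq_self hp]
  congr 1
  unfold shiftedProj
  rw [hq, homogeneousComponent_mul_of_isHomogeneous (isHomogeneous_X k s)]
  by_cases h : j ≤ N
  · rw [if_pos h, if_pos (by omega), if_pos (by omega), show N + 1 - j - 1 = N - j by omega,
      mul_comm]
  · rw [if_neg h, mul_zero]
    split_ifs
    · omega
    · rfl
    · rfl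

end Truncation

/-- Minimal graded free resolutions of the residue field. -/
abbrev ResidueResolution {k A : Type*} [Field k] [CommRing A] [Algebra k A]
    (𝒜 : ℕ → Submodule k A) :=
  MinimalGradedFreeResolution 𝒜 (residueGrading 𝒜)

section ResidueInstances

variable {k : Type*} [Field k] {n c : ℕ}

/-- The additive group of the residue field, for fast instance search. -/
abbrev residueAddCommGroup {k A : Type*} [Field k] [CommRing A] [Algebra k A]
    (𝒜 : ℕ → Submodule k A) : AddCommGroup (A ⧸ irrelevantIdeal 𝒜) :=
  inferInstance

/-- The module structure on the residue field, for fast instance search. -/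
abbrev residueModule {k A : Type*} [Field k] [CommRing A] [Algebra k A]
    (𝒜 : ℕ → Submodule k A) : Module A (A ⧸ irrelevantIdeal 𝒜) :=
  inferInstance

/-- The vector space structure on the residue field, for fast instance search. -/
abbrev residueVectorSpace {k A : Type*} [Field k] [CommRing A] [Algebra k A]
    (𝒜 : ℕ → Submodule k A) : Module k (A ⧸ irrelevantIdeal 𝒜) :=
  inferInstance

noncomputable instance :
    AddCommGroup (veroneseSubring k n c ⧸ irrelevantIdeal (veroneseGrading k n c)) :=
  residueAddCommGroup _

noncomputable instance : Module (veroneseSubring k n c)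
    (veroneseSubring k n c ⧸ irrelevantIdeal (veroneseGrading k n c)) :=
  residueModule _

noncomputable instance :
    Module k (veroneseSubring k n c ⧸ irrelevantIdeal (veroneseGrading k n c)) :=
  residueVectorSpace _

end ResidueInstances

/-! ### Koszulness of Veronese subrings -/

section Koszul

open MvPolynomial MinimalGradedFreeResolution

variable {k : Type*} [Field k] {n c : ℕ}
  (F : ResidueResolution (veroneseGrading k n c))

/-- The differential of the complex obtained from a resolution over the Veronese subring by base
change to the polynomial ring modulo its first `s` variables. -/
noncomputable def truncDiff (s i : ℕ) (v : Fin (F.rank (i + 1)) → MvPolynomial (Fin n) k) :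
    Fin (F.rank i) → MvPolynomial (Fin n) k :=
  fun a => ∑ b, killVars k n s (F.d i (Pi.single b 1) a : MvPolynomial (Fin n) k) * v b

/-- The chains of internal degree `N` in step `i` of the truncated complex. -/
def IsTruncChain (s N i : ℕ) (v : Fin (F.rank i) → MvPolynomial (Fin n) k) : Prop :=
  ∀ b, v b ∈ shiftedComponent k n N (c * F.shift i b) ∧ killVars k n s (v b) = v b

/-- The cycles of the truncated complex. -/
def IsTruncCycle (s : ℕ) : (i : ℕ) → (Fin (F.rank i) → MvPolynomial (Fin n) k) → Prop
  | 0, _ => True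
  | i + 1, v => truncDiff F s i v = 0

/-- Exactness of the truncated complex in step `i` and internal degree `N`. -/
def TruncExact (s N i : ℕ) : Prop :=
  ∀ v, IsTruncChain F s N i v → IsTruncCycle F s i v →
    ∃ w, IsTruncChain F s N (i + 1) w ∧ truncDiff F s i w = v

variable {F}

theorem entry_isHomogeneous (i : ℕ) (b : Fin (F.rank (i + 1))) (a : Fin (F.rank i)) :
    (F.shift i a ≤ F.shift (i + 1) b ∧ (F.d i (Pi.single b 1) a : MvPolynomial (Fin n) k).IsHomogeneous
      (c * F.shift (i + 1) b - c * F.shift i a)) ∨ F.d i (Pi.single b 1) a = 0 := by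
  rcases F.d_homogeneous i b a with ⟨h1, h2⟩ | h
  · refine Or.inl ⟨h1, ?_⟩
    rw [← Nat.mul_sub]
    exact mem_veroneseGrading_iff.1 h2
  · exact Or.inr h

theorem truncDiff_add (s i : ℕ) (v w : Fin (F.rank (i + 1)) → MvPolynomial (Fin n) k) :
    truncDiff F s i (v + w) = truncDiff F s i v + truncDiff F s i w := by
  ext1 a
  simp [truncDiff, mul_add, Finset.sum_add_distrib]

theorem truncDiff_smul (s i : ℕ) (r : MvPolynomial (Fin n) k)
    (v : Fin (F.rank (i + 1)) → MvPolynomial (Fin n) k) :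
    truncDiff F s i (r • v) = r • truncDiff F s i v := by
  ext1 a
  simp [truncDiff, Finset.mul_sum, mul_left_comm]

theorem truncDiff_sub (s i : ℕ) (v w : Fin (F.rank (i + 1)) → MvPolynomial (Fin n) k) :
    truncDiff F s i (v - w) = truncDiff F s i v - truncDiff F s i w := by
  ext1 a
  simp [truncDiff, mul_sub, Finset.sum_sub_distrib]

theorem truncDiff_truncDiff (s i : ℕ) (v : Fin (F.rank (i + 1 + 1)) → MvPolynomial (Fin n) k) :
    truncDiff F s i (truncDiff F s (i + 1) v) = 0 := by
  ext1 a
  have h : ∀ e, ∑ b, (F.d i (Pi.single b 1) a) * F.d (i + 1) (Pi.single e 1) b = 0 := by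
    intro e
    have h1 := congrFun ((F.exact_succ i).apply_apply_eq_zero (Pi.single e 1)) a
    rw [F.d_apply] at h1
    rw [← show _ = (0 : veroneseSubring k n c) from h1]
    exact Finset.sum_congr rfl fun b _ => mul_comm _ _
  have h' : ∀ e, ∑ b, killVars k n s (F.d i (Pi.single b 1) a : MvPolynomial (Fin n) k) *
      killVars k n s (F.d (i + 1) (Pi.single e 1) b : MvPolynomial (Fin n) k) = 0 := by
    intro e
    have h1 := congrArg (fun x : veroneseSubring k n c => killVars k n s (x : MvPolynomial (Fin n) k)) (h e)
    simpa using h1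
  simp only [truncDiff, Finset.mul_sum, ← mul_assoc]
  rw [Finset.sum_comm]
  simp only [← Finset.sum_mul, h', zero_mul, Finset.sum_const_zero, Pi.zero_apply]

theorem killVars_truncDiff {s t : ℕ} (hst : s ≤ t) (i : ℕ)
    (v : Fin (F.rank (i + 1)) → MvPolynomial (Fin n) k) (a : Fin (F.rank i)) :
    killVars k n t (truncDiff F s i v a) = truncDiff F t i (fun b => killVars k n t (v b)) a := by
  simp only [truncDiff, map_sum, map_mul, killVars_killVars hst]

theorem IsTruncChain.truncDiff {s N i : ℕ} {v : Fin (F.rank (i + 1)) → MvPolynomial (Fin n) k}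
    (hv : IsTruncChain F s N (i + 1) v) : IsTruncChain F s N i (truncDiff F s i v) := by
  intro a
  refine ⟨Submodule.sum_mem _ fun b _ => ?_, ?_⟩
  · rcases entry_isHomogeneous i b a with ⟨h1, h2⟩ | h
    · exact mul_mem_shiftedComponent (Nat.mul_le_mul_left c h1) (killVars_isHomogeneous s h2)
        (hv b).1
    · simp [h]
  · rw [killVars_truncDiff le_rfl]
    simp only [(hv _).2]

theorem IsTruncChain.add {s N i : ℕ} {v w : Fin (F.rank i) → MvPolynomial (Fin n) k}
    (hv : IsTruncChain F s N i v) (hw : IsTruncChain F s N i w) : IsTruncChain F s N i (v + w) :=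
  fun b => ⟨Submodule.add_mem _ (hv b).1 (hw b).1, by
    rw [Pi.add_apply, map_add, (hv b).2, (hw b).2]⟩

theorem IsTruncChain.sub {s N i : ℕ} {v w : Fin (F.rank i) → MvPolynomial (Fin n) k}
    (hv : IsTruncChain F s N i v) (hw : IsTruncChain F s N i w) : IsTruncChain F s N i (v - w) :=
  fun b => ⟨Submodule.sub_mem _ (hv b).1 (hw b).1, by
    rw [Pi.sub_apply, map_sub, (hv b).2, (hw b).2]⟩

theorem IsTruncChain.X_smul {N i : ℕ} (s : Fin n) {v : Fin (F.rank i) → MvPolynomial (Fin n) k}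
    (hv : IsTruncChain F s N i v) :
    IsTruncChain F s (N + 1) i ((X s : MvPolynomial (Fin n) k) • v) :=
  fun b => ⟨X_mul_mem_shiftedComponent s (hv b).1, by
    rw [Pi.smul_apply, smul_eq_mul, map_mul, (hv b).2, killVars_X, if_neg (lt_irrefl _)]⟩

theorem IsTruncChain.killVars {s t N i : ℕ} {v : Fin (F.rank i) → MvPolynomial (Fin n) k}
    (hv : IsTruncChain F s N i v) : IsTruncChain F t N i (fun b => killVars k n t (v b)) :=
  fun b => ⟨killVars_mem_shiftedComponent t (hv b).1, killVars_killVars le_rfl _⟩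

/-- The quotient by the first `t` variables is modelled by polynomials not involving them, so its
chains are already chains for smaller `s`. This provides the lifts in the long exact sequence
arguments. -/
theorem IsTruncChain.of_le {s t N i : ℕ} (hst : s ≤ t)
    {v : Fin (F.rank i) → MvPolynomial (Fin n) k}
    (hv : IsTruncChain F t N i v) : IsTruncChain F s N i v :=
  fun b => ⟨(hv b).1, by rw [← (hv b).2, killVars_killVars' hst]⟩

theorem IsTruncChain.exists_X_smul {N i : ℕ} (s : Fin n)
    {v : Fin (F.rank i) → MvPolynomial (Fin n) k} (hv : IsTruncChain F s (N + 1) i v)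
    (h : ∀ b, MvPolynomial.X s ∣ v b ∨ _root_.killVars k n (s + 1) (v b) = 0) :
    ∃ u, IsTruncChain F s N i u ∧ v = (X s : MvPolynomial (Fin n) k) • u := by
  have h' : ∀ b, _root_.killVars k n (s + 1) (v b) = 0 := fun b => by
    rcases h b with ⟨q, hq⟩ | h
    · rw [hq, map_mul, killVars_X, if_pos (Nat.lt_succ_self _), zero_mul]
    · exact h
  choose u hu1 hu2 hu3 using fun b => exists_X_mul_of_mem_shiftedComponent s (hv b).1 (hv b).2 (h' b)
  exact ⟨u, fun b => ⟨hu1 b, hu2 b⟩, funext hu3⟩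

theorem isTruncCycle_of_X_smul {i : ℕ} (s : Fin n) {u : Fin (F.rank i) → MvPolynomial (Fin n) k}
    (h : IsTruncCycle F s i ((X s : MvPolynomial (Fin n) k) • u)) : IsTruncCycle F s i u := by
  cases i with
  | zero => trivial
  | succ i =>
    have h1 : (X s : MvPolynomial (Fin n) k) • truncDiff F s i u = 0 := by
      rw [← truncDiff_smul]; exact h
    exact (smul_eq_zero.1 h1).resolve_left (X_ne_zero s)

/-- Exactness modulo one more variable, from the short exact sequence given by multiplication by
that variable. -/
theorem TruncExact.succ {N i : ℕ} (s : Fin n) (h : TruncExact F s (N + 1) i)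
    (h' : ∀ j, i = j + 1 → TruncExact F s N j) : TruncExact F (s + 1) (N + 1) i := by
  intro v hv hcyc
  have hs : s.val ≤ s.val + 1 := Nat.le_succ _
  obtain ⟨z, hz, hzc, hzv⟩ : ∃ z, IsTruncChain F s (N + 1) i z ∧ IsTruncCycle F s i z ∧
      ∀ b, killVars k n (s + 1) (z b) = v b := by
    cases i with
    | zero => exact ⟨v, hv.of_le hs, trivial, fun b => (hv b).2⟩
    | succ i =>
      have h1 := (hv.of_le hs).truncDiff
      -- Connecting homomorphism: the differential of the lift is `X s` times a cycle `u` one step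
      -- lower. Since `u` bounds some `w`, subtracting `X s • w` turns the lift into a cycle.
      obtain ⟨u, hu, huv⟩ := h1.exists_X_smul s fun a => Or.inr (by
        rw [killVars_truncDiff hs]
        simp only [(hv _).2]
        exact congrFun hcyc a)
      have hucyc : IsTruncCycle F s i u := by
        refine isTruncCycle_of_X_smul s ?_
        rw [← huv]
        cases i with
        | zero => trivial
        | succ i => exact truncDiff_truncDiff _ _ _
      obtain ⟨w, hw, hwu⟩ := h' i rfl u hu hucyc
      refine ⟨v - (X s : MvPolynomial (Fin n) k) • w, (hv.of_le hs).sub (hw.X_smul s), ?_,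
        fun b => ?_⟩
      · change truncDiff F s i _ = 0
        rw [truncDiff_sub, truncDiff_smul, hwu, huv, sub_self]
      · rw [Pi.sub_apply, Pi.smul_apply, smul_eq_mul, map_sub, map_mul, killVars_X,
          if_pos (Nat.lt_succ_self _), zero_mul, sub_zero, (hv b).2]
  obtain ⟨y, hy, hyz⟩ := h z hz hzc
  refine ⟨_, hy.killVars (t := s + 1), ?_⟩
  ext1 a
  rw [← killVars_truncDiff hs, hyz, hzv]

/-- The other part of the same long exact sequence: the homology at `(s, N + 1)` lies between those
at `(s, N)` and `(s + 1, N + 1)` in the same step. -/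
theorem TruncExact.of_succ {N i : ℕ} (s : Fin n) (h : TruncExact F s N i)
    (h' : TruncExact F (s + 1) (N + 1) i) : TruncExact F s (N + 1) i := by
  intro v hv hcyc
  have hs : s.val ≤ s.val + 1 := Nat.le_succ _
  have hcyc' : IsTruncCycle F (s + 1) i (fun b => killVars k n (s + 1) (v b)) := by
    cases i with
    | zero => trivial
    | succ i =>
      ext1 a
      rw [← killVars_truncDiff hs, show truncDiff F s i v = 0 from hcyc]
      simp
  obtain ⟨w, hw, hwv⟩ := h' _ hv.killVars hcyc'
  have hw' := hw.of_le hs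
  obtain ⟨u, hu, huv⟩ := (hv.sub hw'.truncDiff).exists_X_smul s fun b => Or.inr (by
    rw [Pi.sub_apply, map_sub, killVars_truncDiff hs]
    simp only [(hw _).2]
    rw [hwv, sub_self])
  have hucyc : IsTruncCycle F s i u := by
    refine isTruncCycle_of_X_smul s ?_
    rw [← huv]
    cases i with
    | zero => trivial
    | succ i =>
      change truncDiff F s i _ = 0
      rw [truncDiff_sub, truncDiff_truncDiff, sub_zero]
      exact hcyc
  obtain ⟨y, hy, hyu⟩ := h u hu hucyc
  refine ⟨w + (X s : MvPolynomial (Fin n) k) • y, hw'.add (hy.X_smul s), ?_⟩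
  rw [truncDiff_add, truncDiff_smul, hyu, ← huv]
  abel

/-- With all variables killed only constants survive, and these sit in internal degrees divisible by
`c`. -/
theorem truncExact_all_of_not_dvd {N i : ℕ} (h : ¬ c ∣ N) : TruncExact F n N i := by
  intro v hv _
  refine ⟨0, fun b => ⟨Submodule.zero_mem _, map_zero _⟩, ?_⟩
  ext1 a
  have h1 := (hv a).1
  have h2 := (hv a).2
  have h3 : v a = 0 := by
    unfold shiftedComponent at h1
    split_ifs at h1 with hle
    · rw [killVars_all] at h2
      rw [← h2, constantCoeff_eq, IsHomogeneous.coeff_eq_zero h1, map_zero]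
      rw [map_zero]
      intro h0
      exact h ⟨F.shift i a, by omega⟩
    · exact (Submodule.mem_bot k).1 h1
  rw [h3]
  simp [truncDiff]

/-- In internal degree `c * q` the base change to `S` is the degree `q` part of the resolution
itself. Only `k` in degree `0` obstructs exactness at step `0`. -/
theorem truncExact_zero (hc : 0 < c) (q i : ℕ) (h : i = 0 → 0 < q) : TruncExact F 0 (c * q) i := by
  intro v hv hcyc
  have hvR : ∀ b, v b ∈ veroneseSubring k n c ∧ (F.shift i b ≤ q ∨ v b = 0) ∧
      (v b).IsHomogeneous (c * (q - F.shift i b)) := by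
    intro b
    have h1 := (hv b).1
    unfold shiftedComponent at h1
    split_ifs at h1 with hle
    · rw [← Nat.mul_sub] at h1
      exact ⟨mem_veroneseSubring_of_isHomogeneous h1, Or.inl (Nat.le_of_mul_le_mul_left hle hc), h1⟩
    · rw [(Submodule.mem_bot k).1 h1]
      exact ⟨Subalgebra.zero_mem _, Or.inr rfl, isHomogeneous_zero _ _ _⟩
  let v' : Fin (F.rank i) → veroneseSubring k n c := fun b => ⟨v b, (hvR b).1⟩
  obtain ⟨w, hw⟩ : ∃ w, F.d i w = v' := by
    cases i with
    | zero =>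
      refine (F.exact_zero v').1 ?_
      refine F.aug_eq_zero_of_residue (h rfl) fun b hb => mem_veroneseGrading_iff.2 ?_
      have := (hvR b).2.2
      rwa [hb, Nat.sub_zero] at this
    | succ i =>
      refine (F.exact_succ i v').1 ?_
      ext1 a
      apply Subtype.ext
      rw [F.d_apply]
      have h1 := congrFun (show truncDiff F 0 i v = 0 from hcyc) a
      simp only [truncDiff, killVars_zero] at h1
      rw [Pi.zero_apply] at h1 ⊢
      rw [AddSubmonoidClass.coe_finsetSum, Subalgebra.coe_zero, ← h1]
      exact Finset.sum_congr rfl fun b _ => mul_comm _ _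
  refine ⟨fun b => shiftedProj k n (c * q) (c * F.shift (i + 1) b) (w b),
    fun b => ⟨shiftedProj_mem _ _ _, killVars_zero _⟩, ?_⟩
  ext1 a
  have h1 : (v a : MvPolynomial (Fin n) k) =
      ∑ b, (F.d i (Pi.single b 1) a : MvPolynomial (Fin n) k) * w b := by
    have h2 := congrArg Subtype.val (congrFun hw a)
    rw [F.d_apply, AddSubmonoidClass.coe_finsetSum] at h2
    rw [← show _ = v a from h2]
    exact Finset.sum_congr rfl fun b _ => mul_comm _ _
  rw [← shiftedProj_eq_self (hv a).1, h1, shiftedProj_sum]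
  simp only [truncDiff, killVars_zero]
  refine Finset.sum_congr rfl fun b _ => ?_
  rcases entry_isHomogeneous i b a with ⟨h2, h3⟩ | h2
  · rw [shiftedProj_mul (Nat.mul_le_mul_left c h2) h3]
  · rw [h2]
    simp [shiftedProj]

/-- Induction on the step, then on the internal degree. In degrees divisible by `c` exactness is
carried upwards from `s = 0`; in the others it is carried downwards from `s = n`. -/
theorem truncExact_of_le (hc : 0 < c) (i : ℕ) : ∀ N, c * (i + 1) ≤ N → ∀ s ≤ n, TruncExact F s N i := by
  induction i using Nat.strong_induction_on with
  | _ i ihi =>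
  intro N
  induction N with
  | zero =>
    intro h
    have : 0 < c * (i + 1) := Nat.mul_pos hc i.succ_pos
    omega
  | succ N ihN =>
    intro hN s hs
    by_cases hd : c ∣ N + 1
    · obtain ⟨q, hq⟩ := hd
      induction s with
      | zero =>
        rw [hq]
        refine truncExact_zero hc q i fun _ => Nat.pos_of_ne_zero ?_
        rintro rfl
        simp at hq
      | succ s ih =>
        refine TruncExact.succ ⟨s, hs⟩ (ih (by omega)) fun j hj => ?_
        subst hj
        refine ihi j (Nat.lt_succ_self _) N ?_ s (by omega)
        have : c * (j + 1 + 1) = c * (j + 1) + c := by ring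
        omega
    · have hN' : c * (i + 1) ≤ N := by
        rcases hN.lt_or_eq with h | h
        · omega
        · exact absurd ⟨i + 1, h.symm⟩ hd
      induction hs using Nat.decreasingInduction with
      | self => exact truncExact_all_of_not_dvd hd
      | of_succ s hs ih => exact TruncExact.of_succ ⟨s, hs⟩ (ihN hN' s hs.le) ih

/-- The Veronese subrings of a polynomial ring are Koszul. -/
theorem veronese_shift_eq (hc : 0 < c)
    (F : ResidueResolution (veroneseGrading k n c)) (i : ℕ) (b : Fin (F.rank i)) :
    F.shift i b = i := by
  refine le_antisymm ?_ (F.le_shift (veronese_eq_zero_of_mem_zero hc) (veronese_one_notMem hc) i b)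
  by_contra! hlt
  have hz : ∀ j v, truncDiff F n j v = 0 := by
    intro j v
    ext1 a
    refine Finset.sum_eq_zero fun b _ => ?_
    rw [killVars_all, constantCoeff_of_mem_irrelevantIdeal hc (F.d_minimal j b a), map_zero,
      zero_mul]
  -- At `s = n` minimality makes all differentials zero, so a generator of degree above `i` would be
  -- a nonzero homology class in a degree where the complex is exact.
  have hchain : IsTruncChain F n (c * F.shift i b) i (Pi.single b 1) := by
    intro a
    by_cases hab : a = b
    · subst hab
      rw [Pi.single_eq_same, map_one]
      refine ⟨?_, rfl⟩
      unfold shiftedComponent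
      rw [if_pos le_rfl, Nat.sub_self]
      exact isHomogeneous_one _ _
    · rw [Pi.single_eq_of_ne hab, map_zero]
      exact ⟨Submodule.zero_mem _, rfl⟩
  obtain ⟨w, -, hw⟩ := truncExact_of_le hc i _ (Nat.mul_le_mul_left c hlt) n le_rfl _ hchain (by
    cases i with
    | zero => trivial
    | succ i => exact hz _ _)
  rw [hz] at hw
  have := congrFun hw b
  simp at this

theorem veronese_rank_zero (hc : 0 < c)
    (F : ResidueResolution (veroneseGrading k n c)) : F.rank 0 = 1 := by
  have h1 := veronese_one_notMem (k := k) (n := n) hc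
  refine F.rank_zero_of_residue h1 fun x hx y => ?_
  have hx0 : constantCoeff (x : MvPolynomial (Fin n) k) ≠ 0 := fun h =>
    hx (mem_irrelevantIdeal_of_constantCoeff h)
  refine ⟨algebraMap k _ (constantCoeff (y : MvPolynomial (Fin n) k) /
    constantCoeff (x : MvPolynomial (Fin n) k)), mem_irrelevantIdeal_of_constantCoeff ?_⟩
  simp [algebraMap_eq, hx0]

end Koszul

/-! ### Euler characteristic of the resolution -/

theorem sum_neg_one_pow_mul_finrank {k : Type*} [Field k] {V : ℕ → Type*}
    [∀ p, AddCommGroup (V p)] [∀ p, Module k (V p)] [∀ p, FiniteDimensional k (V p)]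
    (f : ∀ p, V (p + 1) →ₗ[k] V p) (hsurj : Function.Surjective (f 0))
    (hex : ∀ p, Function.Exact (f (p + 1)) (f p)) (q : ℕ) :
    ∑ p ∈ Finset.range (q + 1), (-1 : ℤ) ^ p * Module.finrank k (V p) =
      (-1) ^ q * Module.finrank k (LinearMap.range (f q)) := by
  induction q with
  | zero =>
    rw [LinearMap.range_eq_top.2 hsurj, finrank_top]
    simp
  | succ q ih =>
    have h1 := (f q).finrank_range_add_finrank_ker
    rw [(hex q).linearMap_ker_eq] at h1
    rw [Finset.sum_range_succ, ih, ← h1]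
    push_cast
    ring

section Euler

open MvPolynomial

variable {k : Type*} [Field k] {n c : ℕ}

theorem finite_homogeneousSubmodule (d : ℕ) :
    FiniteDimensional k (homogeneousSubmodule (Fin n) k d) :=
  Module.Finite.iff_fg.2 (homogeneousSubmodule_fg (Fin n) k d)

theorem shiftedComponent_of_le {N j : ℕ} (h : j ≤ N) :
    shiftedComponent k n N j = homogeneousSubmodule (Fin n) k (N - j) :=
  if_pos h

theorem shiftedComponent_of_not_le {N j : ℕ} (h : ¬ j ≤ N) : shiftedComponent k n N j = ⊥ :=
  if_neg h

theorem finite_shiftedComponent (N j : ℕ) :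
    FiniteDimensional k (shiftedComponent k n N j) := by
  by_cases h : j ≤ N
  · rw [shiftedComponent_of_le h]
    exact finite_homogeneousSubmodule _
  · rw [shiftedComponent_of_not_le h]
    infer_instance

theorem finrank_shiftedComponent (N j : ℕ) : Module.finrank k (shiftedComponent k n N j) =
    if j ≤ N then Module.finrank k (homogeneousSubmodule (Fin n) k (N - j)) else 0 := by
  by_cases h : j ≤ N
  · rw [shiftedComponent_of_le h, if_pos h]
  · rw [shiftedComponent_of_not_le h, if_neg h, finrank_bot]

theorem truncDiff_smul' {F : ResidueResolution (veroneseGrading k n c)} (s i : ℕ) (r : k)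
    (v : Fin (F.rank (i + 1)) → MvPolynomial (Fin n) k) (a : Fin (F.rank i)) :
    truncDiff F s i (fun b => r • v b) a = r • truncDiff F s i v a := by
  simp only [truncDiff, Finset.smul_sum, mul_smul_comm]

/-- The Euler characteristic of the minimal resolution of the residue field of a Veronese subring
in internal degree `q`. -/
theorem veronese_euler (hc : 0 < c) (F : ResidueResolution (veroneseGrading k n c)) (q : ℕ) :
    ∑ p ∈ Finset.range (q + 1), (-1 : ℤ) ^ p * (F.rank p *
      Module.finrank k (homogeneousSubmodule (Fin n) k (c * (q - p)))) =
      if q = 0 then 1 else 0 := by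
  rcases Nat.eq_zero_or_pos q with rfl | hq
  · have h1 : Module.finrank k (homogeneousSubmodule (Fin n) k 0) = 1 := by
      rw [homogeneousSubmodule_zero, Submodule.one_eq_span]
      exact finrank_span_singleton one_ne_zero
    simp [veronese_rank_zero hc F, h1]
  rw [if_neg hq.ne']
  let V (p : ℕ) : Type _ := (b : Fin (F.rank p)) → shiftedComponent k n (c * q) (c * F.shift p b)
  let : ∀ p, AddCommGroup (V p) := fun p => Pi.addCommGroup
  let : ∀ p, Module k (V p) := fun p => Pi.module _ _ _
  have hchain : ∀ p (v : V p), IsTruncChain F 0 (c * q) p (fun b => (v b).1) := fun p v b =>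
    ⟨(v b).2, killVars_zero _⟩
  let f (p : ℕ) : V (p + 1) →ₗ[k] V p :=
    { toFun := fun v a => ⟨truncDiff F 0 p (fun b => (v b).1) a, ((hchain _ v).truncDiff a).1⟩
      map_add' := fun v w => by
        ext1 a
        apply Subtype.ext
        exact congrFun (truncDiff_add 0 p _ _) a
      map_smul' := fun r v => by
        ext1 a
        exact Subtype.ext (truncDiff_smul' 0 p r (fun b => (v b).1) a) }
  have hfin : ∀ p (b : Fin (F.rank p)),
      FiniteDimensional k (shiftedComponent k n (c * q) (c * F.shift p b)) :=
    fun p b => finite_shiftedComponent _ _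
  have hfinV : ∀ p, FiniteDimensional k (V p) := fun p => Module.Finite.pi
  have hlift : ∀ p w, IsTruncChain F 0 (c * q) p w → ∃ w' : V p, (fun b => (w' b).1) = w :=
    fun p w hw => ⟨fun b => ⟨w b, (hw b).1⟩, rfl⟩
  have hsurj : Function.Surjective (f 0) := by
    intro v
    obtain ⟨w, hw, hwv⟩ := truncExact_zero hc q 0 (fun _ => hq) _ (hchain 0 v) trivial
    obtain ⟨w', rfl⟩ := hlift _ _ hw
    exact ⟨w', funext fun a => Subtype.ext (congrFun hwv a)⟩
  have hex : ∀ p, Function.Exact (f (p + 1)) (f p) := by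
    intro p v
    constructor
    · intro hv
      obtain ⟨w, hw, hwv⟩ := truncExact_zero hc q (p + 1) (fun h => absurd h p.succ_ne_zero) _
        (hchain _ v) (funext fun a => congrArg Subtype.val (congrFun hv a))
      obtain ⟨w', rfl⟩ := hlift _ _ hw
      exact ⟨w', funext fun a => Subtype.ext (congrFun hwv a)⟩
    · rintro ⟨w, rfl⟩
      exact funext fun a => Subtype.ext (congrFun (truncDiff_truncDiff 0 p _) a)
  have hdim : ∀ p, Module.finrank k (V p) = if p ≤ q then F.rank p *
      Module.finrank k (homogeneousSubmodule (Fin n) k (c * (q - p))) else 0 := by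
    intro p
    rw [Module.finrank_pi_fintype]
    have h : ∀ b, Module.finrank k (shiftedComponent k n (c * q) (c * F.shift p b)) =
        if p ≤ q then Module.finrank k (homogeneousSubmodule (Fin n) k (c * (q - p))) else 0 := by
      intro b
      rw [finrank_shiftedComponent, veronese_shift_eq hc F, Nat.mul_sub]
      exact if_congr (Nat.mul_le_mul_left_iff hc) rfl rfl
    rw [Finset.sum_congr rfl fun b _ => h b, Finset.sum_const, Finset.card_univ, Fintype.card_fin,
      smul_eq_mul, mul_ite, mul_zero]
  have h1 := sum_neg_one_pow_mul_finrank f hsurj hex q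
  -- By Koszulness the generators of step `q + 1` have degree above `q`, so the complex stops at
  -- step `q`.
  have h2 : Module.finrank k (LinearMap.range (f q)) = 0 := by
    have h3 := LinearMap.finrank_range_le (f q)
    rw [hdim (q + 1), if_neg (by omega)] at h3
    omega
  rw [h2, Nat.cast_zero, mul_zero] at h1
  refine Eq.trans (Finset.sum_congr rfl fun p hp => ?_) h1
  have h3 := (hdim p).trans (if_pos (Nat.lt_succ_iff.1 (Finset.mem_range.1 hp)))
  rw [h3, Nat.cast_mul]

end Euler

/-! ### Krull dimension and Hilbert function -/

theorem ringKrullDim_eq_of_isIntegral {R S : Type*} [CommRing R] [CommRing S] [Algebra R S]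
    [IsDomain R] [IsDomain S] [Algebra.IsIntegral R S] [FaithfulSMul R S] :
    ringKrullDim R = ringKrullDim S := by
  let f : PrimeSpectrum S → PrimeSpectrum R := PrimeSpectrum.comap (algebraMap R S)
  have hf : StrictMono f := fun I J hIJ => Ideal.IsIntegral.comap_lt_comap hIJ
  -- Incomparability makes contraction strictly monotone and going up lifts chains. In domains both
  -- dimensions are the coheight of the zero ideal.
  have h := Order.coheight_eq_of_strictMono f hf (fun I P hIP => by
    obtain ⟨Q, hQ, hQp, hQP⟩ := Ideal.exists_ideal_over_prime_of_isIntegral (S := S) P.asIdeal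
      I.asIdeal hIP.le
    have hfQ : f ⟨Q, hQp⟩ = P := PrimeSpectrum.ext hQP
    refine ⟨⟨Q, hQp⟩, lt_of_le_of_ne hQ ?_, hfQ⟩
    rintro rfl
    exact hIP.ne hfQ) ⊥
  have hbot : f ⊥ = ⊥ := by
    apply PrimeSpectrum.ext
    change Ideal.comap (algebraMap R S) ⊥ = ⊥
    rw [← RingHom.ker_eq_comap_bot]
    exact (RingHom.injective_iff_ker_eq_bot _).1 (FaithfulSMul.algebraMap_injective R S)
  rw [hbot] at h
  unfold ringKrullDim
  rw [← Order.coheight_bot_eq_krullDim, ← Order.coheight_bot_eq_krullDim, h]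

section Hilbert

open MvPolynomial

variable (k : Type*) [Field k] (n c : ℕ)

theorem finrank_homogeneousSubmodule (d : ℕ) :
    Module.finrank k (homogeneousSubmodule (Fin n) k d) = n.multichoose d := by
  rw [homogeneousSubmodule_eq_finsupp_supported,
    (AddMonoidAlgebra.supportedEquivFinsupp _).finrank_eq]
  have hset : {m : Fin n →₀ ℕ | m.degree = d} =
      ((Finset.univ.finsuppAntidiag d : Finset (Fin n →₀ ℕ)) : Set (Fin n →₀ ℕ)) := by
    ext m
    simp [Finsupp.degree_eq_sum]
  rw [hset, Module.finrank_finsupp_self]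
  refine (Fintype.card_coe _).trans ?_
  rw [Finset.card_finsuppAntidiag_nat_eq_multichoose, Finset.card_univ, Fintype.card_fin]

theorem finrank_veroneseGrading (i : ℕ) :
    Module.finrank k (veroneseGrading k n c i) = n.multichoose (c * i) := by
  rw [← finrank_homogeneousSubmodule k]
  refine LinearEquiv.finrank_eq (LinearEquiv.ofBijective
    (((veroneseSubring k n c).val.toLinearMap.comp (veroneseGrading k n c i).subtype).codRestrict
      (homogeneousSubmodule (Fin n) k (c * i)) fun x => x.2) ⟨?_, ?_⟩)
  · intro x y h
    exact Subtype.ext (Subtype.ext (congrArg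
      (fun z : homogeneousSubmodule (Fin n) k (c * i) => (z : MvPolynomial (Fin n) k)) h))
  · rintro ⟨p, hp⟩
    exact ⟨⟨⟨p, mem_veroneseSubring_of_isHomogeneous hp⟩, hp⟩, rfl⟩

theorem ringKrullDim_veroneseSubring (hc : 0 < c) :
    ringKrullDim (veroneseSubring k n c) = n := by
  have hX : ∀ i : Fin n, IsIntegral (veroneseSubring k n c) (X i : MvPolynomial (Fin n) k) := by
    intro i
    refine IsIntegral.of_pow hc ?_
    have h : (X i ^ c : MvPolynomial (Fin n) k) ∈ veroneseSubring k n c :=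
      mem_veroneseSubring_of_isHomogeneous (i := 1) (by
        rw [mul_one]; exact isHomogeneous_X_pow i c)
    exact isIntegral_algebraMap (R := veroneseSubring k n c) (x := ⟨_, h⟩)
  have : Algebra.IsIntegral (veroneseSubring k n c) (MvPolynomial (Fin n) k) := by
    refine ⟨fun p => ?_⟩
    induction p using MvPolynomial.induction_on with
    | C a => exact isIntegral_algebraMap (R := veroneseSubring k n c) (x := algebraMap k _ a)
    | add p q hp hq => exact hp.add hq
    | mul_X p i hp => exact hp.mul (hX i)
  rw [ringKrullDim_eq_of_isIntegral (R := veroneseSubring k n c) (S := MvPolynomial (Fin n) k)]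
  simp

end Hilbert

/-! ### The h-polynomials and their values at -1 -/

section HPolynomial

theorem coeff_mul_one_sub_X_pow (f : ℕ → ℤ) (n j : ℕ) :
    PowerSeries.coeff j (PowerSeries.mk f * (1 - PowerSeries.X) ^ n) =
      ∑ l ∈ Finset.range (j + 1), (-1) ^ l * (n.choose l : ℤ) * f (j - l) := by
  have h : ((1 - PowerSeries.X) ^ n : ℤ⟦X⟧) = ((1 - Polynomial.X : ℤ[X]) ^ n : ℤ[X]) := by simp
  have hc : ∀ l, ((1 - Polynomial.X : ℤ[X]) ^ n).coeff l = (-1) ^ l * (n.choose l : ℤ) := by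
    intro l
    have h1 : (1 - Polynomial.X : ℤ[X]) ^ n =
        ((1 + Polynomial.X : ℤ[X]) ^ n).comp (Polynomial.C (-1) * Polynomial.X) := by
      simp [sub_eq_add_neg]
    rw [h1, Polynomial.comp_C_mul_X_coeff, Polynomial.coeff_one_add_X_pow, mul_comm]
  rw [mul_comm, PowerSeries.coeff_mul, Finset.Nat.sum_antidiagonal_eq_sum_range_succ_mk]
  refine Finset.sum_congr rfl fun l _ => ?_
  rw [h, Polynomial.coeff_coe, hc, PowerSeries.coeff_mk]

variable (k : Type*) [Field k] {n c : ℕ}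

/-- The `h`-vector of a Veronese subring. -/
def veroneseHCoeff (n c j : ℕ) : ℤ :=
  ∑ l ∈ Finset.range (j + 1), (-1) ^ l * (n.choose l : ℤ) * (n.multichoose (c * (j - l)) : ℤ)

/-- `hvan` says that the `n`-th difference of the Hilbert function vanishes, as expected for a
polynomial of degree `n - 1` when `n > 0`. It bounds the degree of the numerator below `n`. -/
theorem isHPolynomial_veronese (hc : 0 < c)
    (hvan : ∀ i, ∑ l ∈ Finset.range (n + 1),
      (-1) ^ l * (n.choose l : ℤ) * (n.multichoose (c * (i + n - l)) : ℤ) = 0) :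
    IsHPolynomial (veroneseGrading k n c)
      (∑ j ∈ Finset.range n, Polynomial.monomial j (veroneseHCoeff n c j)) := by
  refine ⟨n, ringKrullDim_veroneseSubring k n c hc, ?_⟩
  ext j
  unfold gradedHilbertSeries
  simp only [finrank_veroneseGrading]
  rw [coeff_mul_one_sub_X_pow, Polynomial.coeff_coe, Polynomial.finsetSum_coeff]
  simp only [Polynomial.coeff_monomial, Finset.sum_ite_eq', Finset.mem_range]
  split_ifs with hj
  · rfl
  · obtain ⟨i, rfl⟩ := Nat.exists_eq_add_of_le' (not_lt.1 hj)
    rw [← hvan i]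
    refine Finset.sum_subset (Finset.range_mono (by omega)) fun l _ hl => ?_
    rw [Nat.choose_eq_zero_of_lt (by simpa using hl)]
    simp

theorem eval_neg_one_sum_monomial (n : ℕ) (a : ℕ → ℤ) :
    (∑ j ∈ Finset.range n, Polynomial.monomial j (a j)).eval (-1) =
      ∑ j ∈ Finset.range n, a j * (-1) ^ j := by
  simp [Polynomial.eval_finsetSum]

/-- Clearing the factorial shows the Hilbert function as a polynomial in `d`, which reduces the
difference identities and evaluations below to polynomial arithmetic. -/
theorem factorial_mul_multichoose_succ (n d : ℕ) :
    (n.factorial : ℤ) * ((n + 1).multichoose d : ℤ) = ∏ i ∈ Finset.range n, ((d : ℤ) + 1 + i) := by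
  rw [Nat.multichoose_eq, show n + 1 + d - 1 = d + n by omega, Nat.choose_symm_add,
    ← Nat.cast_mul, ← Nat.ascFactorial_eq_factorial_mul_choose, Nat.ascFactorial_eq_prod_range]
  push_cast
  rfl

theorem multichoose_four (d : ℕ) :
    (6 : ℤ) * (Nat.multichoose 4 d : ℤ) = (d + 1) * (d + 2) * (d + 3) := by
  have := factorial_mul_multichoose_succ 3 d
  simp only [Finset.prod_range_succ, Finset.prod_range_zero, Nat.factorial] at this
  push_cast at this
  linarith

theorem multichoose_five (d : ℕ) :
    (24 : ℤ) * (Nat.multichoose 5 d : ℤ) = (d + 1) * (d + 2) * (d + 3) * (d + 4) := by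
  have := factorial_mul_multichoose_succ 4 d
  simp only [Finset.prod_range_succ, Finset.prod_range_zero, Nat.factorial] at this
  push_cast at this
  linarith

theorem multichoose_seven (d : ℕ) : (720 : ℤ) * (Nat.multichoose 7 d : ℤ) =
    (d + 1) * (d + 2) * (d + 3) * (d + 4) * (d + 5) * (d + 6) := by
  have := factorial_mul_multichoose_succ 6 d
  simp only [Finset.prod_range_succ, Finset.prod_range_zero, Nat.factorial] at this
  push_cast at this
  linarith

theorem isHPolynomial_veronese_four (hc : 0 < c) : IsHPolynomial (veroneseGrading k 4 c)
    (∑ j ∈ Finset.range 4, Polynomial.monomial j (veroneseHCoeff 4 c j)) := by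
  refine isHPolynomial_veronese k hc fun i => ?_
  rw [← mul_right_inj' (show (6 : ℤ) ≠ 0 by norm_num), Finset.mul_sum]
  simp only [mul_left_comm (6 : ℤ), multichoose_four, Finset.sum_range_succ, Finset.sum_range_zero]
  simp [Nat.choose, show i + 4 - 1 = i + 3 by omega, show i + 4 - 2 = i + 2 by omega,
    show i + 4 - 3 = i + 1 by omega]
  ring

theorem isHPolynomial_veronese_five (hc : 0 < c) : IsHPolynomial (veroneseGrading k 5 c)
    (∑ j ∈ Finset.range 5, Polynomial.monomial j (veroneseHCoeff 5 c j)) := by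
  refine isHPolynomial_veronese k hc fun i => ?_
  rw [← mul_right_inj' (show (24 : ℤ) ≠ 0 by norm_num), Finset.mul_sum]
  simp only [mul_left_comm (24 : ℤ), multichoose_five, Finset.sum_range_succ, Finset.sum_range_zero]
  simp [Nat.choose, show i + 5 - 1 = i + 4 by omega, show i + 5 - 2 = i + 3 by omega,
    show i + 5 - 3 = i + 2 by omega, show i + 5 - 4 = i + 1 by omega]
  ring

theorem isHPolynomial_veronese_seven (hc : 0 < c) : IsHPolynomial (veroneseGrading k 7 c)
    (∑ j ∈ Finset.range 7, Polynomial.monomial j (veroneseHCoeff 7 c j)) := by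
  refine isHPolynomial_veronese k hc fun i => ?_
  rw [← mul_right_inj' (show (720 : ℤ) ≠ 0 by norm_num), Finset.mul_sum]
  simp only [mul_left_comm (720 : ℤ), multichoose_seven, Finset.sum_range_succ,
    Finset.sum_range_zero]
  simp [Nat.choose, show i + 7 - 1 = i + 6 by omega, show i + 7 - 2 = i + 5 by omega,
    show i + 7 - 3 = i + 4 by omega, show i + 7 - 4 = i + 3 by omega,
    show i + 7 - 5 = i + 2 by omega, show i + 7 - 6 = i + 1 by omega]
  ring

theorem eval_veronese_four (c : ℕ) :
    3 * (∑ j ∈ Finset.range 4, Polynomial.monomial j (veroneseHCoeff 4 c j)).eval (-1) =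
      ((c : ℤ) - 4) * (c ^ 2 + 4 * c - 6) := by
  rw [eval_neg_one_sum_monomial]
  have h0 := multichoose_four (c * 0)
  have h1 := multichoose_four (c * 1)
  have h2 := multichoose_four (c * 2)
  have h3 := multichoose_four (c * 3)
  simp only [veroneseHCoeff, Finset.sum_range_succ, Finset.sum_range_zero, Nat.choose,
    Nat.reduceSub, Nat.sub_self, Nat.sub_zero]
  push_cast at *
  linarith

theorem eval_veronese_five_four :
    (∑ j ∈ Finset.range 5, Polynomial.monomial j (veroneseHCoeff 5 4 j)).eval (-1) = 56 := by
  rw [eval_neg_one_sum_monomial]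
  have h0 := multichoose_five (4 * 0)
  have h1 := multichoose_five (4 * 1)
  have h2 := multichoose_five (4 * 2)
  have h3 := multichoose_five (4 * 3)
  have h4 := multichoose_five (4 * 4)
  simp only [veroneseHCoeff, Finset.sum_range_succ, Finset.sum_range_zero, Nat.choose,
    Nat.reduceSub, Nat.sub_self, Nat.sub_zero]
  push_cast at *
  linarith

theorem eval_veronese_five_three :
    (∑ j ∈ Finset.range 5, Polynomial.monomial j (veroneseHCoeff 5 3 j)).eval (-1) = 11 := by
  rw [eval_neg_one_sum_monomial]
  have h0 := multichoose_five (3 * 0)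
  have h1 := multichoose_five (3 * 1)
  have h2 := multichoose_five (3 * 2)
  have h3 := multichoose_five (3 * 3)
  have h4 := multichoose_five (3 * 4)
  simp only [veroneseHCoeff, Finset.sum_range_succ, Finset.sum_range_zero, Nat.choose,
    Nat.reduceSub, Nat.sub_self, Nat.sub_zero]
  push_cast at *
  linarith

theorem eval_veronese_seven_two :
    (∑ j ∈ Finset.range 7, Polynomial.monomial j (veroneseHCoeff 7 2 j)).eval (-1) = 8 := by
  rw [eval_neg_one_sum_monomial]
  have h0 := multichoose_seven (2 * 0)
  have h1 := multichoose_seven (2 * 1)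
  have h2 := multichoose_seven (2 * 2)
  have h3 := multichoose_seven (2 * 3)
  have h4 := multichoose_seven (2 * 4)
  have h5 := multichoose_seven (2 * 5)
  have h6 := multichoose_seven (2 * 6)
  simp only [veroneseHCoeff, Finset.sum_range_succ, Finset.sum_range_zero, Nat.choose,
    Nat.reduceSub, Nat.sub_self, Nat.sub_zero]
  push_cast at *
  linarith

end HPolynomial

/-! ### The diagonal of the Golod identity -/

namespace MinimalGradedFreeResolution

variable {k A M : Type*} [Field k] [CommRing A] [Algebra k A] {𝒜 : ℕ → Submodule k A}
  [AddCommGroup M] [Module k M] [Module A M] {ℳ : ℕ → Submodule k M}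

theorem coeff_coeff_poincareSeries (F : MinimalGradedFreeResolution 𝒜 ℳ) (e i : ℕ) :
    (PowerSeries.coeff i F.poincareSeries).coeff (i + e) = F.bettiDiag e i := by
  unfold poincareSeries bettiDiag
  rw [PowerSeries.coeff_mk, Polynomial.finsetSum_coeff]
  simp only [Polynomial.coeff_X_pow, Finset.sum_boole, eq_comm]

/-- `R` is cyclic over `A`: some generator of degree `0` has nonzero image, a scalar, and by
minimality it is the only generator. -/
theorem bettiDiag_one_zero_eq_zero {R : Type*} [CommRing R] [Algebra k R]
    {ℛ : ℕ → Submodule k R} [Module A R] (G : MinimalGradedFreeResolution 𝒜 ℛ) (φ : A →ₐ[k] R)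
    (hsmul : ∀ (x : A) (y : R), x • y = φ x * y) (hφ : Function.Surjective φ)
    (h1 : (1 : A) ∉ irrelevantIdeal 𝒜) (hR1 : (1 : R) ∉ irrelevantIdeal ℛ)
    (hR0 : ∀ y ∈ ℛ 0, ∃ c : k, y = algebraMap k R c) : G.bettiDiag 1 0 = 0 := by
  obtain ⟨a, ha, ha'⟩ : ∃ a, G.shift 0 a = 0 ∧ G.aug (Pi.single a 1) ≠ 0 := by
    by_contra! h
    obtain ⟨v, hv⟩ := G.aug_surjective 1
    rw [G.aug_apply] at hv
    refine hR1 (hv ▸ Ideal.sum_mem _ fun b _ => ?_)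
    rw [hsmul]
    refine Ideal.mul_mem_left _ _ ?_
    by_cases hb : G.shift 0 b = 0
    · rw [h b hb]; exact Ideal.zero_mem _
    · exact Ideal.subset_span ⟨_, Nat.pos_of_ne_zero hb, G.aug_homogeneous b⟩
  have hmem := G.aug_homogeneous a
  rw [ha] at hmem
  obtain ⟨c, hc⟩ := hR0 _ hmem
  have hc0 : c ≠ 0 := by
    rintro rfl
    exact ha' (by rw [hc, map_zero])
  have huniq := G.eq_of_aug_generates h1 (a := a) fun y => by
    obtain ⟨x, hx⟩ := hφ (y * algebraMap k R c⁻¹)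
    exact ⟨x, by rw [hsmul, hx, hc, mul_assoc, ← map_mul, inv_mul_cancel₀ hc0, map_one, mul_one]⟩
  unfold bettiDiag
  rw [Finset.card_eq_zero, Finset.filter_eq_empty_iff]
  intro b _
  rw [huniq b, ha]
  omega

end MinimalGradedFreeResolution

section Veronese

variable {k : Type*} [Field k] {n c : ℕ}

theorem mk_rank_mul_mk_eq_one (hc : 0 < c) (F : ResidueResolution (veroneseGrading k n c)) :
    (PowerSeries.mk fun i => (F.rank i : ℤ)) *
      (PowerSeries.mk fun i => (-1) ^ i * (n.multichoose (c * i) : ℤ)) = 1 := by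
  ext q
  rw [PowerSeries.coeff_mul, Finset.Nat.sum_antidiagonal_eq_sum_range_succ_mk,
    PowerSeries.coeff_one]
  simp only [PowerSeries.coeff_mk]
  have h := congrArg (fun z => (-1 : ℤ) ^ q * z) (veronese_euler hc F q)
  simp only [finrank_homogeneousSubmodule] at h
  have h2 : (-1 : ℤ) ^ q * (if q = 0 then 1 else 0) = if q = 0 then 1 else 0 := by
    split_ifs with hq
    · simp [hq]
    · simp
  rw [h2, Finset.mul_sum] at h
  rw [← h]
  refine Finset.sum_congr rfl fun p hp => ?_
  have hpq : p ≤ q := Nat.lt_succ_iff.1 (Finset.mem_range.1 hp)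
  have h3 : (-1 : ℤ) ^ q = (-1) ^ p * (-1) ^ (q - p) := by rw [← pow_add, Nat.add_sub_cancel' hpq]
  have h4 : (-1 : ℤ) ^ p * (-1) ^ p = 1 := by rw [← mul_pow]; simp
  rw [h3]
  linear_combination (-(F.rank p : ℤ) * (-1) ^ (q - p) * (n.multichoose (c * (q - p)) : ℤ)) * h4

/-- The identity of linear strands given by a Golod morphism onto a Veronese subring. -/
theorem exists_diagonal_identity (hc : 0 < c) {Q : Type*} [CommRing Q] [Algebra k Q]
    {𝒬 : ℕ → Submodule k Q} (hstd : IsStandardGraded 𝒬) (hCI : IsGradedCompleteIntersection 𝒬)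
    {φ : Q →ₐ[k] veroneseSubring k n c} (hφ : IsGolodSurjection 𝒬 (veroneseGrading k n c) φ) :
    ∃ (r D B : ℕ → ℕ), PolyGrowth D ∧ B 0 = 0 ∧ B 1 = 0 ∧
      (PowerSeries.mk fun i => (r i : ℤ)) *
        (PowerSeries.mk fun i => (-1) ^ i * (n.multichoose (c * i) : ℤ)) = 1 ∧
      (PowerSeries.mk fun i => (r i : ℤ)) * (1 - PowerSeries.mk fun i => (B i : ℤ)) =
        PowerSeries.mk fun i => (D i : ℤ) := by
  let _ : Module Q (veroneseSubring k n c) :=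
    Module.compHom _ (φ : Q →+* veroneseSubring k n c)
  obtain ⟨hsurj, hdeg, hker, FA, FR, G, hG⟩ := hφ
  have := hstd.nontrivial
  have h1 : (1 : Q) ∉ irrelevantIdeal 𝒬 := fun h =>
    one_ne_zero (hstd.eq_zero_of_mem_zero (by
      rw [hstd.zero_eq]
      exact Submodule.one_le.1 le_rfl) h)
  have hG0 : G.bettiDiag 1 0 = 0 :=
    G.bettiDiag_one_zero_eq_zero φ (fun _ _ => rfl) hsurj h1 (veronese_one_notMem hc) fun y hy => by
      have h2 := mem_veroneseGrading_iff.1 hy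
      rw [mul_zero, ← MvPolynomial.totalDegree_zero_iff_isHomogeneous,
        MvPolynomial.totalDegree_eq_zero_iff_eq_C] at h2
      exact ⟨_, Subtype.ext h2⟩
  -- The factor `z` in the Golod denominator raises the step by one, so its diagonal consists of the
  -- generators of degree `i` in step `i - 1`. The subtracted `1` has degree `0` and does not meet
  -- it.
  refine ⟨FR.rank, FA.bettiDiag 0, fun i => if i = 0 then 0 else G.bettiDiag 1 (i - 1),
    FA.polyGrowth_bettiDiag hstd hCI, rfl, hG0, mk_rank_mul_mk_eq_one hc FR, ?_⟩
  ext i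
  have h2 := congrArg (fun s => (PowerSeries.coeff i s).coeff i) hG
  rw [PowerSeries.coeff_mk, ← FA.coeff_coeff_poincareSeries 0 i, add_zero, ← h2,
    PowerSeries.coeff_mul, PowerSeries.coeff_mul, Polynomial.finsetSum_coeff]
  refine Finset.sum_congr rfl fun pq hpq => ?_
  obtain ⟨p, q⟩ := pq
  obtain rfl : p + q = i := Finset.HasAntidiagonal.mem_antidiagonal.1 hpq
  -- Since the series of `R` lies on the diagonal, taking diagonals commutes with multiplication by
  -- it.
  have hR : PowerSeries.coeff p FR.poincareSeries = (FR.rank p : ℤ[X]) * Polynomial.X ^ p := by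
    unfold MinimalGradedFreeResolution.poincareSeries
    rw [PowerSeries.coeff_mk]
    simp [veronese_shift_eq hc FR]
  rw [hR, mul_assoc, ← Polynomial.C_eq_natCast, Polynomial.coeff_C_mul, add_comm p q,
    Polynomial.coeff_X_pow_mul, PowerSeries.coeff_mk]
  congr 1
  cases q with
  | zero => simp
  | succ q =>
    rw [map_sub, map_sub, PowerSeries.coeff_succ_X_mul, map_sub, PowerSeries.coeff_one,
      PowerSeries.coeff_one, if_neg q.succ_ne_zero, if_neg q.succ_ne_zero, Polynomial.coeff_sub,
      Polynomial.coeff_sub, G.coeff_coeff_poincareSeries 1 q, PowerSeries.coeff_one]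
    split_ifs <;> simp [Polynomial.coeff_one]

end Veronese

/-! ### Evaluation near 1 -/

section Analysis

open Filter Topology

theorem hasSum_coeff_mul (p : ℤ[X]) (D : ℤ⟦X⟧) (u s : ℝ)
    (h : HasSum (fun i => ((PowerSeries.coeff i D : ℤ) : ℝ) * u ^ i) s) :
    HasSum (fun i => ((PowerSeries.coeff i ((p : ℤ⟦X⟧) * D) : ℤ) : ℝ) * u ^ i)
      (Polynomial.aeval u p * s) := by
  induction p using Polynomial.induction_on' with
  | add p q hp hq =>
    convert hp.add hq using 1
    · ext i
      simp [add_mul]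
    · rw [map_add, add_mul]
  | monomial e a =>
    rw [← hasSum_nat_add_iff' e]
    have hfun : (fun i => ((PowerSeries.coeff (i + e)
        ((Polynomial.monomial e a : ℤ[X]) * D : ℤ⟦X⟧) : ℤ) : ℝ) * u ^ (i + e)) =
        fun i => (a * u ^ e : ℝ) * (((PowerSeries.coeff i D : ℤ) : ℝ) * u ^ i) := by
      funext i
      rw [Polynomial.coe_monomial, PowerSeries.monomial_eq_C_mul_X_pow, mul_assoc,
        PowerSeries.coeff_C_mul, PowerSeries.coeff_X_pow_mul]
      push_cast
      ring
    rw [Finset.sum_eq_zero, sub_zero, hfun]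
    · simpa using h.mul_left (a * u ^ e : ℝ)
    · intro i hi
      rw [Polynomial.coe_monomial, PowerSeries.monomial_eq_C_mul_X_pow, mul_assoc,
        PowerSeries.coeff_C_mul, PowerSeries.coeff_X_pow_mul', if_neg]
      · simp
      · simpa using hi

theorem PolyGrowth.summable {a : ℕ → ℕ} (h : PolyGrowth a) {u : ℝ} (h0 : 0 < u) (h1 : u < 1) :
    Summable fun i => (a i : ℝ) * u ^ i := by
  obtain ⟨C, d, hC⟩ := h
  have hu : ‖u‖ < 1 := by rwa [Real.norm_of_nonneg h0.le]
  have h2 : Summable fun i : ℕ => ((i + 1 : ℕ) : ℝ) ^ d * u ^ (i + 1) :=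
    (summable_nat_add_iff (f := fun i : ℕ => (i : ℝ) ^ d * u ^ i) 1).2
      (summable_pow_mul_geometric_of_norm_lt_one d hu)
  refine Summable.of_nonneg_of_le (fun i => by positivity) (fun i => ?_) (h2.mul_left (C / u))
  have h3 : (a i : ℝ) ≤ C * ((i + 1 : ℕ) : ℝ) ^ d := by exact_mod_cast hC i
  calc (a i : ℝ) * u ^ i ≤ C * ((i + 1 : ℕ) : ℝ) ^ d * u ^ i := by gcongr
    _ = C / u * (((i + 1 : ℕ) : ℝ) ^ d * u ^ (i + 1)) := by
      rw [pow_succ]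
      field_simp

/-- The difference `(1 + z)^n - p D = B (1 + z)^n` has nonnegative coefficients and converges on
`(0, 1)` because `D` does; convergence of `B` itself is not needed. -/
theorem eval_mul_le_two_pow {n : ℕ} {D B : ℕ → ℕ} {p : ℤ[X]} (hD : PolyGrowth D)
    (h : (p : ℤ⟦X⟧) * PowerSeries.mk (fun i => (D i : ℤ)) =
      (1 - PowerSeries.mk fun i => (B i : ℤ)) * (1 + PowerSeries.X) ^ n) :
    p.eval 1 * (D 0 + D 1) ≤ 2 ^ n := by
  have key : ∀ u : ℝ, 0 < u → u < 1 →
      Polynomial.aeval u p * (D 0 + D 1 * u) ≤ (1 + u) ^ n := by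
    intro u h0 h1
    obtain ⟨s, hs⟩ := hD.summable h0 h1
    have hsD : HasSum (fun i => ((PowerSeries.coeff i (PowerSeries.mk fun i => (D i : ℤ)) : ℤ) : ℝ) *
        u ^ i) s := by
      simpa using hs
    have hone : HasSum (fun i => ((PowerSeries.coeff i (1 : ℤ⟦X⟧) : ℤ) : ℝ) * u ^ i) 1 := by
      convert hasSum_ite_eq 0 (1 : ℝ) using 2 with i
      rw [PowerSeries.coeff_one]
      split_ifs with hi <;> simp [hi]
    have hq := hasSum_coeff_mul ((1 + Polynomial.X) ^ n) 1 u 1 hone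
    have hp := hasSum_coeff_mul p _ u s hsD
    have hdiff := hq.sub hp
    have hnn : 0 ≤ Polynomial.aeval u ((1 + Polynomial.X : ℤ[X]) ^ n) * 1 -
        Polynomial.aeval u p * s := by
      refine hdiff.nonneg fun i => ?_
      rw [← sub_mul, ← Int.cast_sub, ← map_sub, h]
      refine mul_nonneg (Int.cast_nonneg ?_) (by positivity)
      have h2 : (((1 + Polynomial.X : ℤ[X]) ^ n : ℤ[X]) : ℤ⟦X⟧) = (1 + PowerSeries.X) ^ n := by simp
      rw [h2, mul_one, sub_mul, one_mul, sub_sub_cancel, ← h2, PowerSeries.coeff_mul]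
      refine Finset.sum_nonneg fun x _ => ?_
      rw [PowerSeries.coeff_mk, Polynomial.coeff_coe, Polynomial.coeff_one_add_X_pow]
      positivity
    have hs2 : (D 0 + D 1 * u : ℝ) ≤ s := by
      have := sum_le_hasSum (Finset.range 2) (fun i _ => by positivity) hs
      simpa [Finset.sum_range_succ] using this
    have hev : Polynomial.aeval u ((1 + Polynomial.X : ℤ[X]) ^ n) = (1 + u) ^ n := by simp
    rw [hev, mul_one] at hnn
    rcases le_or_gt 0 (Polynomial.aeval u p) with hpu | hpu
    -- Truncating `D` after two terms is legitimate only for `p(u) ≥ 0`; for negative `p(u)` the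
    -- inequality is a matter of signs.
    · nlinarith [mul_le_mul_of_nonneg_left hs2 hpu]
    · have h3 : (0 : ℝ) ≤ D 0 + D 1 * u := by positivity
      have h4 : (0 : ℝ) ≤ (1 + u) ^ n := by positivity
      nlinarith [mul_nonneg (neg_nonneg.2 hpu.le) h3]
  have hcont1 : Continuous fun u : ℝ => Polynomial.aeval u p * (D 0 + D 1 * u) := by
    fun_prop
  have hcont2 : Continuous fun u : ℝ => (1 + u) ^ n := by fun_prop
  have hlim : Polynomial.aeval (1 : ℝ) p * (D 0 + D 1 * 1) ≤ (1 + 1) ^ n := by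
    refine le_of_tendsto_of_tendsto (b := 𝓝[<] (1 : ℝ)) (hcont1.continuousWithinAt.tendsto)
      (hcont2.continuousWithinAt.tendsto) ?_
    filter_upwards [Ioo_mem_nhdsLT (show (0 : ℝ) < 1 by norm_num)] with u hu
    exact key u hu.1 hu.2
  have hev : Polynomial.aeval (1 : ℝ) p = (p.eval 1 : ℤ) := by
    rw [Polynomial.aeval_def, Polynomial.eval₂_at_one]
    simp
  rw [hev, mul_one] at hlim
  norm_num at hlim
  exact_mod_cast hlim

end Analysis

/-! ### The obstruction and the main theorem -/

/-- The obstruction to the Backelin-Roos property for Veronese subrings. -/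
theorem eval_neg_one_mul_le_of_hasBackelinRoosProperty {k : Type*} [Field k] {n c : ℕ} (hc : 0 < c)
    {h : ℤ[X]} (hh : IsHPolynomial (veroneseGrading k n c) h)
    (hBR : HasBackelinRoosProperty (veroneseGrading k n c)) :
    h.eval (-1) * (1 + n.multichoose c) ≤ 2 ^ n := by
  obtain ⟨Q, _, _, 𝒬, φ, hstd, hCI, hφ⟩ := hBR
  obtain ⟨r, D, B, hD, hB0, hB1, hr, hrD⟩ := exists_diagonal_identity hc hstd hCI hφ
  obtain ⟨d, hd, hd'⟩ := hh
  obtain rfl : n = d := by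
    rw [ringKrullDim_veroneseSubring k n c hc] at hd
    exact_mod_cast hd
  set H : ℤ⟦X⟧ := PowerSeries.mk fun i => (-1) ^ i * (n.multichoose (c * i) : ℤ) with hH
  have hH' : PowerSeries.rescale (-1) (gradedHilbertSeries (veroneseGrading k n c)) = H := by
    ext i
    rw [PowerSeries.coeff_rescale, hH, PowerSeries.coeff_mk, gradedHilbertSeries,
      PowerSeries.coeff_mk, finrank_veroneseGrading]
  have hcomp : ((h.comp (Polynomial.C (-1) * Polynomial.X) : ℤ[X]) : ℤ⟦X⟧) =
      H * (1 + PowerSeries.X) ^ n := by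
    have h1 := congrArg (PowerSeries.rescale (-1 : ℤ)) hd'
    rw [map_mul, hH', map_pow, map_sub, map_one, PowerSeries.rescale_X] at h1
    rw [show (1 + PowerSeries.X : ℤ⟦X⟧) = 1 - PowerSeries.C (-1) * PowerSeries.X by simp, ← h1]
    ext i
    rw [Polynomial.coeff_coe, Polynomial.comp_C_mul_X_coeff, PowerSeries.coeff_rescale,
      Polynomial.coeff_coe, mul_comm]
  -- Multiplying `r (1 - B) = D` by `h(-z) = H (1 + z)^n` and using `r H = 1` eliminates `r`.
  have hmain : ((h.comp (Polynomial.C (-1) * Polynomial.X) : ℤ[X]) : ℤ⟦X⟧) *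
      PowerSeries.mk (fun i => (D i : ℤ)) =
      (1 - PowerSeries.mk fun i => (B i : ℤ)) * (1 + PowerSeries.X) ^ n := by
    rw [hcomp, ← hrD]
    linear_combination (1 - PowerSeries.mk fun i => (B i : ℤ)) * (1 + PowerSeries.X) ^ n * hr
  have hle := eval_mul_le_two_pow hD hmain
  have hr0 : (r 0 : ℤ) = 1 := by
    have := congrArg (PowerSeries.coeff 0) hr
    simpa [hH, PowerSeries.coeff_mul] using this
  have hr1 : (r 1 : ℤ) = n.multichoose c := by
    have := congrArg (PowerSeries.coeff 1) hr
    simp [hH, PowerSeries.coeff_mul, Finset.Nat.antidiagonal_succ, PowerSeries.coeff_one, hr0] at this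
    linarith
  have hD0 : (D 0 : ℤ) = 1 := by
    have := congrArg (PowerSeries.coeff 0) hrD
    simpa [PowerSeries.coeff_mul, hB0, hr0, eq_comm] using this
  have hD1 : (D 1 : ℤ) = n.multichoose c := by
    have := congrArg (PowerSeries.coeff 1) hrD
    simp [PowerSeries.coeff_mul, Finset.Nat.antidiagonal_succ, PowerSeries.coeff_one, hB0, hB1]
      at this
    rw [← this, hr1]
  rw [hD0, hD1] at hle
  simpa using hle

theorem mainTheorem10 {k : Type*} [Field k] :
    (∀ n c : ℕ, IsObstructedPair n c →
      ∃ h : ℤ[X], IsHPolynomial (veroneseGrading k n c) h ∧ 0 < h.eval (-1)) ∧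
    (∀ c : ℕ, 1 ≤ c →
      ∃ h : ℤ[X], IsHPolynomial (veroneseGrading k 4 c) h ∧
        ((h.eval (-1) : ℤ) : ℚ) = ((c : ℚ) - 4) * ((c : ℚ) ^ 2 + 4 * (c : ℚ) - 6) / 3) ∧
    (∀ n c : ℕ, IsObstructedPair n c → ¬ HasBackelinRoosProperty (veroneseGrading k n c)) := by
  have key : ∀ n c : ℕ, IsObstructedPair n c → ∃ h : ℤ[X],
      IsHPolynomial (veroneseGrading k n c) h ∧ 0 < h.eval (-1) ∧ 0 < c ∧
      2 ^ n < h.eval (-1) * (1 + n.multichoose c) := by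
    rintro n c (⟨rfl, rfl⟩ | ⟨rfl, rfl⟩ | ⟨rfl, rfl⟩ | ⟨rfl, hc⟩)
    · refine ⟨_, isHPolynomial_veronese_seven k (by norm_num), ?_, by norm_num, ?_⟩ <;>
        rw [eval_veronese_seven_two]
      · norm_num
      · have := multichoose_seven 2
        norm_num at this ⊢
        omega
    · refine ⟨_, isHPolynomial_veronese_five k (by norm_num), ?_, by norm_num, ?_⟩ <;>
        rw [eval_veronese_five_four]
      · norm_num
      · have := multichoose_five 4
        norm_num at this ⊢
        omega
    · refine ⟨_, isHPolynomial_veronese_five k (by norm_num), ?_, by norm_num, ?_⟩ <;>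
        rw [eval_veronese_five_three]
      · norm_num
      · have := multichoose_five 3
        norm_num at this ⊢
        omega
    · refine ⟨_, isHPolynomial_veronese_four k (by omega), ?_, by omega, ?_⟩
      all_goals
        have h1 := eval_veronese_four c
        have h2 := multichoose_four c
        have hc' : (5 : ℤ) ≤ c := by exact_mod_cast hc
        set x := (∑ j ∈ Finset.range 4, Polynomial.monomial j (veroneseHCoeff 4 c j)).eval (-1)
        have hx : 0 < x := by nlinarith
      · exact hx
      -- As `h(-1) ≥ 1`, a value of at least `16 = 2^4` for `dim R_1` is enough.
      · have h3 : (16 : ℤ) ≤ Nat.multichoose 4 c := by nlinarith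
        nlinarith
  refine ⟨fun n c hnc => ?_, fun c hc => ?_, fun n c hnc hBR => ?_⟩
  · obtain ⟨h, h1, h2, -⟩ := key n c hnc
    exact ⟨h, h1, h2⟩
  · refine ⟨_, isHPolynomial_veronese_four k hc, ?_⟩
    have h1 := congrArg (Int.cast : ℤ → ℚ) (eval_veronese_four c)
    push_cast at h1 ⊢
    linarith
  · obtain ⟨h, h1, -, hc, h2⟩ := key n c hnc
    exact absurd (eval_neg_one_mul_le_of_hasBackelinRoosProperty hc h1 hBR) (not_le.2 h2)
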